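/- Let $p$ be a prime. A \emph{$T$-group} is a nontrivial pro-$p$ group $T$ which has a maximal closed subgroup $N$ (maximal among proper closed subgroups) that is abelian of exponent dividing $p$. For a $T$-group $T$ let $Z(T)$ be its center, $Z(T)[p]$ the subgroup of elements of $Z(T)$ of order dividing $p$, let $T_{(1)}=T$ and $T_{(n+1)}=\overline{[T_{(n)},T]}$ be its (closed) lower central series, and let $T^p$ be the closed subgroup generated by the $p$-th powers. Define the invariants \[ t_1=\dim_{\mathbb{F}_p}H^1\!\left(\frac{Z(T)[p]}{Z(T)\cap T_{(2)}},\mathbb{F}_p\right),\qquad t_i=\dim_{\mathbb{F}_p}H^1\!\left(\frac{Z(T)\cap T_{(i)}}{Z(T)\cap T_{(i+1)}},\mathbb{F}_p\right)\quad(2\le i\le p), \] \[ u=\max\{i:\ 1\le i\le p,\ T^p\subseteq T_{(i)}\}, \] where $H^1(A,\mathbb{F}_p)$ is the $\mathbb{F}_p$-vector space of continuous homomorphisms $A\to\mathbb{F}_p$ and the dimensions are (possibly infinite) cardinals. For arbitrary cardinals $t_1,\dots,t_p$ and an integer $u$ with $1\le u\le p$, the following are equivalent: (1) $t_1,\dots,t_p$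 and $u$ are the invariants of some $T$-group; (2) (a) if $u<p$ then $t_u\ge 1$, and (b) if $u=p$ and $t_i=0$ for all $2\le i\le p$, then $t_1\ge 1$. Moreover, $T$-groups are determined up to isomorphism by these invariants: if two $T$-groups (for the same $p$) have the same invariants $t_1,\dots,t_p$ and $u$, then they are isomorphic as topological groups. -/

import Mathlib

universe v

namespace TGroups

/-- A profinite group (compact, totally disconnected topological group) is pro-`p` if its quotient
by every open normal subgroup is a (necessarily finite) `p`-group. -/
def IsProP (p : ℕ) (T : ProfiniteGrp.{v}) : Prop :=
  ∀ U : OpenNormalSubgroup T, IsPGroup p (T ⧸ U.toSubgroup)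

/-- `N` is maximal among the proper closed subgroups of `T`. -/
def IsMaximalClosed {T : Type v} [Group T] [TopologicalSpace T] (N : Subgroup T) : Prop :=
  Maximal (fun H : Subgroup T => IsClosed (H : Set T) ∧ H ≠ ⊤) N

/-- A `T`-group: a nontrivial pro-`p` group with a maximal closed subgroup that is abelian of
exponent dividing `p`. -/
structure IsTGroup (p : ℕ) (T : ProfiniteGrp.{v}) : Prop where
  nontrivial : Nontrivial T
  proP : IsProP p T
  exists_maximal : ∃ N : Subgroup T, IsMaximalClosed N ∧
    (∀ a ∈ N, ∀ b ∈ N, a * b = b * a) ∧ ∀ a ∈ N, a ^ p = 1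

section Invariants

variable (p : ℕ) (T : Type v) [Group T] [TopologicalSpace T] [IsTopologicalGroup T]

/-- The (closed) lower central series `T_(n)`, indexed so that `T_(1) = T` and `T_(n+1)` is the
closed subgroup generated by the commutators of `T_(n)` with `T`. (The index `0` is not used.) -/
def centralSeries : ℕ → Subgroup T
  | 0 => ⊤
  | 1 => ⊤
  | n + 2 => (⁅centralSeries (n + 1), (⊤ : Subgroup T)⁆).topologicalClosure

/-- `T^p`: the closed subgroup generated by the `p`-th powers. -/
def powerSubgroup : Subgroup T :=
  (Subgroup.closure (Set.range fun x : T => x ^ p)).topologicalClosure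

/-- `Z(T)[p]`: the central elements of order dividing `p`. -/
def centerTorsion : Subgroup T where
  carrier := {z | z ∈ Subgroup.center T ∧ z ^ p = 1}
  one_mem' := ⟨Subgroup.one_mem _, one_pow p⟩
  mul_mem' := by
    rintro a b ⟨ha, ha'⟩ ⟨hb, hb'⟩
    refine ⟨Subgroup.mul_mem _ ha hb, ?_⟩
    have hab : Commute a b := (Subgroup.mem_center_iff.mp hb) a
    rw [hab.mul_pow, ha', hb', one_mul]
  inv_mem' := by
    rintro a ⟨ha, ha'⟩
    exact ⟨Subgroup.inv_mem _ ha, by rw [inv_pow, ha', inv_one]⟩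

instance center_inf_subgroupOf_normal {G : Type v} [Group G] (A K : Subgroup G) :
    ((Subgroup.center G ⊓ K).subgroupOf A).Normal where
  conj_mem := by
    rintro n hn g
    have hc : (n : G) ∈ Subgroup.center G := (Subgroup.mem_subgroupOf.mp hn).1
    have h : g * n * g⁻¹ = n := by
      apply Subtype.ext
      have := Subgroup.mem_center_iff.mp hc (g : G)
      simp [this]
    rwa [h]

/-- `H¹(A, 𝔽_p)` for the trivial action of the topological group `A` on the discrete group `𝔽_p`:
the `𝔽_p`-vector space of continuous homomorphisms `A → 𝔽_p` (these are the continuous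
1-cocycles, and the 1-coboundaries vanish). -/
def H1 (A : Type v) [Group A] [TopologicalSpace A] : Submodule (ZMod p) (A → ZMod p) where
  carrier := {f | Continuous f ∧ ∀ a b, f (a * b) = f a + f b}
  zero_mem' := ⟨continuous_const, by simp⟩
  add_mem' := by
    rintro f g ⟨hf, hf'⟩ ⟨hg, hg'⟩
    refine ⟨hf.add hg, fun a b => ?_⟩
    simp only [Pi.add_apply, hf', hg']
    abel
  smul_mem' := by
    rintro c f ⟨hf, hf'⟩
    refine ⟨continuous_const.mul hf, fun a b => ?_⟩
    simp only [Pi.smul_apply, hf', smul_add]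

/-- `dim H¹(A / (A ∩ Z(T) ∩ K), 𝔽_p)`, where the quotient carries the quotient topology. -/
noncomputable def dimH1 (A K : Subgroup T) : Cardinal.{v} :=
  Module.rank (ZMod p) (H1 p (A ⧸ (Subgroup.center T ⊓ K).subgroupOf A))

/-- The invariants `t_i`, `1 ≤ i ≤ p`:
`t_1 = dim H¹(Z(T)[p] / (Z(T) ∩ T_(2)), 𝔽_p)`, and
`t_i = dim H¹((Z(T) ∩ T_(i)) / (Z(T) ∩ T_(i+1)), 𝔽_p)` for `2 ≤ i ≤ p`. -/
noncomputable def tInv (i : ℕ) : Cardinal.{v} :=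
  if i = 1 then dimH1 p T (centerTorsion p T) (centralSeries T 2)
  else dimH1 p T (Subgroup.center T ⊓ centralSeries T i) (centralSeries T (i + 1))

/-- The invariant `u = max {i : 1 ≤ i ≤ p, T^p ⊆ T_(i)}`; for `p ≥ 1` the set is finite and
contains `1`. -/
noncomputable def uInv : ℕ :=
  sSup {i : ℕ | 1 ≤ i ∧ i ≤ p ∧ powerSubgroup p T ≤ centralSeries T i}

end Invariants

end TGroups

/-! Let `N` be a maximal closed subgroup that is elementary abelian. It is open and normal, and some
`σ` outside `N` has `σ ^ p ∈ N`. Conjugation by `σ` acts on `N` as `1 + x`; since `σ ^ p` commutes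
with `N` and the characteristic is `p`, `x ^ p = 0`. So `T` is encoded by `N`, `x` and the vector `z
= σ ^ p`, which `x` kills (`CyclicDatum`, `Presentation`).

To normalize the pair `(x, z)`, pass to the continuous dual of `N`, a discrete vector space where
the transpose `X` of `x` is nilpotent and evaluation at `z` is a functional vanishing on the range
of `X`. A Jordan basis of `X`, which exists in any dimension and can be adapted to this functional
(`exists_isJordanFamily`), makes `N` a product of Jordan blocks such that `z` either is the socle
vector of one block of length less than `p`, or lies in the range of `x ^ (p - 1)`
(`exists_coord_equiv`). As `1 + (1 + x) + ... + (1 + x) ^ (p - 1) = x ^ (p - 1)`, in the latter case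
another choice of `σ` gives `z = 0`. Hence `T` is determined by the block lengths and at most one
marked length less than `p`.

The invariants recover these data. `T_(k+1)` is the range of `x ^ k` for `k ≥ 1`, and `ker x` is
`Z(T)[p]` unless `T` is elementary abelian, so `t_i` counts the blocks of length `i`; and `u` is the
marked length, or `p` if there is none. If `T` is elementary abelian, `σ` also contributes to `t_1`,
so that case is treated apart. Conversely, multiplication of the normal forms `φ m * σ ^ a` depends
only on the datum, which gives both uniqueness and the construction of a group from any datum. -/

namespace TGroups

/-! ### Duality for profinite `𝔽_p`-vector spaces. -/

section Duality

variable {p : ℕ} [Fact p.Prime] {M : Type v} [AddCommGroup M] [Module (ZMod p) M]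
  [TopologicalSpace M] [CompactSpace M]

/-- Continuous characters separate the points of a profinite `𝔽_p`-vector space. -/
theorem exists_character_ne_zero [IsTopologicalAddGroup M] [TotallyDisconnectedSpace M]
    {m : M} (hm : m ≠ 0) :
    ∃ χ : M →L[ZMod p] ZMod p, χ m ≠ 0 := by
  have : T2Space M := inferInstance
  obtain ⟨U, hU⟩ := ProfiniteGrp.exist_openNormalAddSubgroup_sub_open_nhds_of_zero
    (G := M) (U := {m}ᶜ) isOpen_compl_singleton (by simpa using hm.symm)
  have hmU : m ∉ AddSubgroup.toZModSubmodule p U.toAddSubgroup := fun h =>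
    hU (show m ∈ (U : Set M) from h) rfl
  obtain ⟨f, hf, hle⟩ := Submodule.exists_le_ker_of_notMem hmU
  refine ⟨⟨f, ?_⟩, hf⟩
  refine continuous_of_continuousAt_zero f ?_
  rw [ContinuousAt, map_zero, nhds_discrete (ZMod p), Filter.tendsto_pure]
  filter_upwards [U.isOpen'.mem_nhds U.zero_mem] with x hx
  exact hle hx

/-- A linearly independent family of continuous characters of a compact space takes every family
of values. -/
theorem exists_forall_character_eq {ι : Type*} {χ : ι → M →L[ZMod p] ZMod p}
    (hχ : LinearIndependent (ZMod p) χ) (a : ι → ZMod p) : ∃ m, ∀ i, χ i m = a i := by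
  classical
  -- A proper range for finitely many characters would be killed by a nonzero functional, which is a
  -- linear relation between them; compactness then handles the whole family.
  have hfin : ∀ J : Finset ι, ∃ m, ∀ i ∈ J, χ i m = a i := by
    intro J
    let F : M →ₗ[ZMod p] (J → ZMod p) := LinearMap.pi fun i => (χ i : M →ₗ[ZMod p] ZMod p)
    have hF : LinearMap.range F = ⊤ := by
      by_contra h
      obtain ⟨g, hg0, hg⟩ := Submodule.exists_le_ker_of_lt_top _ (lt_top_iff_ne_top.mpr h)
      apply hg0
      have hgx : ∀ x, g x = ∑ i, x i * g (Pi.single i 1) := by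
        intro x
        conv_lhs => rw [pi_eq_sum_univ' x]
        simp [map_sum, map_smul]
      have h0 : ∑ i : J, g (Pi.single i 1) • χ i = 0 := by
        ext m
        have := hg (LinearMap.mem_range_self F m)
        rw [LinearMap.mem_ker, hgx] at this
        simpa [F, mul_comm] using this
      have := Fintype.linearIndependent_iff.mp
        (hχ.comp (fun i : J => (i : ι)) Subtype.val_injective) _ h0
      ext i
      simp [this]
    obtain ⟨m, hm⟩ := LinearMap.range_eq_top.mp hF (fun i => a i)
    exact ⟨m, fun i hi => congrFun hm ⟨i, hi⟩⟩
  have hne : (⋂ i, {m | χ i m = a i}).Nonempty := by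
    refine CompactSpace.iInter_nonempty
      (fun i => isClosed_eq (χ i).continuous continuous_const) fun J => ?_
    obtain ⟨m, hm⟩ := hfin J
    exact ⟨m, by simpa using hm⟩
  obtain ⟨m, hm⟩ := hne
  exact ⟨m, by simpa using hm⟩

/-- A spanning family of characters of a profinite `𝔽_p`-vector space separates points. -/
theorem eq_of_forall_character_eq [IsTopologicalAddGroup M] [TotallyDisconnectedSpace M] {ι : Type*}
    {χ : ι → M →L[ZMod p] ZMod p} (hχ : ⊤ ≤ Submodule.span (ZMod p) (Set.range χ)) {m n : M}
    (h : ∀ i, χ i m = χ i n) : m = n := by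
  by_contra hmn
  obtain ⟨ψ, hψ⟩ := exists_character_ne_zero (p := p) (sub_ne_zero.mpr hmn)
  refine hψ ?_
  have hmem : ψ ∈ Submodule.span (ZMod p) (Set.range χ) := hχ trivial
  -- The hypothesis `hψ` depends on `ψ`, so it becomes a premise of the induction hypotheses; this
  -- is the reason for the case distinctions.
  induction hmem using Submodule.span_induction with
  | mem x hx =>
    obtain ⟨i, rfl⟩ := hx
    rw [map_sub, h, sub_self]
  | zero => rfl
  | add x y _ _ hx hy =>
    by_cases hx0 : x (m - n) = 0
    · by_cases hy0 : y (m - n) = 0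
      · simp [hx0, hy0]
      · exact absurd (hy hy0) hy0
    · exact absurd (hx hx0) hx0
  | smul c x _ hx =>
    by_cases hx0 : x (m - n) = 0
    · simp [hx0]
    · exact absurd (hx hx0) hx0

end Duality

/-! ### The dimension of `H¹` of a power of `𝔽_p`. -/

section RankH1

variable {p : ℕ} [Fact p.Prime] {Q : Type v} [Group Q] [TopologicalSpace Q] [CompactSpace Q]

/-- If `Q` is isomorphic to the power `𝔽_p ^ I`, then `H¹(Q, 𝔽_p)` has dimension `#I`. -/
theorem rank_H1_eq {I : Type v} (g : Q → I → ZMod p) (hc : Continuous g)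
    (hb : Function.Bijective g) (hg : ∀ a b, g (a * b) = g a + g b) :
    Module.rank (ZMod p) (H1 p Q) = Cardinal.mk I := by
  classical
  let e : Q ≃ₜ (I → ZMod p) :=
    Continuous.homeoOfEquivCompactToT2 (f := Equiv.ofBijective g hb) hc
  have he : ∀ a, e a = g a := fun _ => rfl
  have hes : ∀ x y, e.symm (x + y) = e.symm x * e.symm y := by
    intro x y
    apply e.injective
    rw [he (_ * _), hg, ← he, ← he]
    simp
  have hadd : ∀ {χ : Q → ZMod p}, (∀ a b, χ (a * b) = χ a + χ b) →
      ∃ ψ : (I → ZMod p) →ₗ[ZMod p] ZMod p, ∀ x, ψ x = χ (e.symm x) := by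
    intro χ hχ
    exact ⟨(AddMonoidHom.mk' (fun x => χ (e.symm x))
      (fun x y => by rw [hes, hχ])).toZModLinearMap p, fun _ => rfl⟩
  let c : I → H1 p Q := fun i => ⟨fun q => g q i, (continuous_apply i).comp hc,
    fun a b => congrFun (hg a b) i⟩
  have hcv : ∀ i q, (c i : Q → ZMod p) q = g q i := fun _ _ => rfl
  have hli : LinearIndependent (ZMod p) c := by
    rw [linearIndependent_iff']
    intro s a h i hi
    obtain ⟨q, hq⟩ := hb.2 (Pi.single i 1)
    have h1 := congrFun (congrArg Subtype.val h) q
    simp only [Submodule.coe_sum, Submodule.coe_smul, Finset.sum_apply, Pi.smul_apply, hcv, hq,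
      smul_eq_mul, Pi.single_apply, mul_ite, mul_one, mul_zero, Finset.sum_ite_eq', hi, if_true,
      Submodule.coe_zero, Pi.zero_apply] at h1
    exact h1
  have hspan : ⊤ ≤ Submodule.span (ZMod p) (Set.range c) := by
    rintro ⟨χ, hχc, hχ⟩ -
    obtain ⟨ψ, hψ⟩ := hadd hχ
    have hψc : Continuous ψ := by
      have : (ψ : (I → ZMod p) → ZMod p) = χ ∘ e.symm := funext hψ
      rw [this]
      exact hχc.comp e.symm.continuous
    -- The kernel is a neighbourhood of zero in the product topology, so the character depends on
    -- finitely many coordinates only.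
    have hopen : {x | ψ x = 0} ∈ nhds (0 : I → ZMod p) :=
      ((isOpen_discrete {(0 : ZMod p)}).preimage hψc).mem_nhds (by simp)
    rw [nhds_pi, Filter.mem_pi] at hopen
    obtain ⟨J, hJ, t, ht, hsub⟩ := hopen
    have hker : ∀ x : I → ZMod p, (∀ i ∈ J, x i = 0) → ψ x = 0 := fun x hx =>
      hsub fun i hi => by rw [hx i hi]; exact mem_of_mem_nhds (ht i)
    have hsum : (⟨χ, hχc, hχ⟩ : H1 p Q) = ∑ i ∈ hJ.toFinset, ψ (Pi.single i 1) • c i := by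
      apply Subtype.ext
      funext q
      have h1 : ψ (g q - ∑ i ∈ hJ.toFinset, g q i • Pi.single i (1 : ZMod p)) = 0 := by
        apply hker
        intro i hi
        simp [Finset.sum_apply, Pi.single_apply, hi]
      have h2 : ψ (g q) = χ q := by rw [hψ, ← he]; simp
      rw [map_sub, sub_eq_zero, h2, map_sum] at h1
      simp only [h1, Submodule.coe_sum, Submodule.coe_smul, Finset.sum_apply, Pi.smul_apply, hcv,
        map_smul, smul_eq_mul]
      exact Finset.sum_congr rfl fun i _ => mul_comm _ _
    rw [hsum]
    exact Submodule.sum_mem _ fun i _ => Submodule.smul_mem _ _ (Submodule.subset_span ⟨i, rfl⟩)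
  exact (Module.Basis.mk hli hspan).mk_eq_rank''.symm

end RankH1

/-! ### Jordan bases of nilpotent endomorphisms in arbitrary dimension, adapted to a functional. -/

section Jordan

open Submodule

variable {K : Type*} [Field K] {V : Type v} [AddCommGroup V] [Module K V]

/-- A nonzero functional is a coordinate function of a suitable basis. -/
theorem exists_basis_functional (F : V →ₗ[K] K) (hF : F ≠ 0) :
    ∃ (ι : Type v) (b : Module.Basis ι K V) (i₀ : ι), F (b i₀) = 1 ∧ ∀ i, i ≠ i₀ → F (b i) = 0 := by
  obtain ⟨v, hv⟩ : ∃ v, F v = 1 := by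
    obtain ⟨y, hy⟩ : ∃ y, F y ≠ 0 := by
      by_contra! h
      exact hF (LinearMap.ext h)
    exact ⟨(F y)⁻¹ • y, by simp [hy]⟩
  let e : (K × LinearMap.ker F) ≃ₗ[K] V := LinearEquiv.ofLinearMap
    ((LinearMap.toSpanSingleton K V v).coprod (LinearMap.ker F).subtype)
    (F.prod ((LinearMap.id - (LinearMap.toSpanSingleton K V v).comp F).codRestrict _
      (fun y => by simp [hv])))
    (by ext y; simp)
    (by
      apply LinearMap.ext
      rintro ⟨a, y, hy⟩
      have hy' : F y = 0 := hy
      ext <;> simp [hv, hy'])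
  have he : ∀ x, F (e x) = x.1 := by
    rintro ⟨a, y, hy⟩
    have hy' : F y = 0 := hy
    simp [e, hv, hy']
  refine ⟨PUnit.{v + 1} ⊕ _, ((Module.Basis.singleton PUnit.{v + 1} K).prod
    (Module.Basis.ofVectorSpace K (LinearMap.ker F))).map e, Sum.inl PUnit.unit, ?_, ?_⟩
  · simp [he]
  · rintro (i | i) hi
    · exact absurd rfl hi
    · simp [he]

/-- The vectors of the kernel of `X` of height at least `k`. -/
def socle (X : Module.End K V) (k : ℕ) : Submodule K V :=
  LinearMap.ker X ⊓ LinearMap.range (X ^ k)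

/-- A choice of generators of the Jordan blocks of size `k + 1` of `X`. -/
structure IsBlockFamily (X : Module.End K V) (k : ℕ) {ι : Type*} (w : ι → V) : Prop where
  pow_eq_zero : ∀ a, (X ^ (k + 1)) (w a) = 0
  indep : LinearIndependent K fun a => (X ^ k) (w a)
  disjoint : Disjoint (span K (Set.range fun a => (X ^ k) (w a))) (socle X (k + 1))
  le : socle X k ≤ span K (Set.range fun a => (X ^ k) (w a)) ⊔ socle X (k + 1)

theorem socle_succ_le (X : Module.End K V) (k : ℕ) : socle X (k + 1) ≤ socle X k := by
  rintro _ ⟨h, y, rfl⟩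
  exact ⟨h, X y, by rw [pow_succ]; rfl⟩

theorem pow_apply_mem_socle {X : Module.End K V} {k : ℕ} {v : V} (hv : (X ^ (k + 1)) v = 0) :
    (X ^ k) v ∈ socle X k :=
  ⟨by change X ((X ^ k) v) = 0; rw [← Module.End.mul_apply, ← pow_succ', hv], v, rfl⟩

/-- By the modular law, a complement of the smaller socle in `V`, cut down to the larger one, still
complements. A basis of `C` indexes the blocks of size `k + 1`. -/
theorem exists_socle_compl (X : Module.End K V) (k : ℕ) :
    ∃ C : Submodule K V, C ≤ socle X k ∧ Disjoint C (socle X (k + 1)) ∧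
      socle X k ≤ C ⊔ socle X (k + 1) := by
  obtain ⟨D, hD⟩ := (socle X (k + 1)).exists_isCompl
  refine ⟨D ⊓ socle X k, inf_le_right, hD.symm.disjoint.mono_left inf_le_left, ?_⟩
  rw [sup_comm, ← sup_inf_assoc_of_le D (socle_succ_le X k), hD.sup_eq_top, top_inf_eq]

/-- Any lifts through `X ^ k` of a basis of `C` will do. This leaves the freedom to change
generators by elements of `ker (X ^ k)`, which is used to control their values under `f`. -/
theorem isBlockFamily_of_basis {X : Module.End K V} {k : ℕ} {C : Submodule K V}
    (hC : C ≤ socle X k) (hd : Disjoint C (socle X (k + 1))) (hle : socle X k ≤ C ⊔ socle X (k + 1))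
    {ι : Type*} (b : Module.Basis ι K C) {w : ι → V} (hw : ∀ a, (X ^ k) (w a) = b a) :
    IsBlockFamily X k w := by
  have hspan : span K (Set.range fun a => (X ^ k) (w a)) = C := by
    have h1 : (Set.range fun a => (X ^ k) (w a)) = C.subtype '' Set.range b := by
      rw [← Set.range_comp]
      exact congrArg Set.range (funext hw)
    rw [h1, span_image, b.span_eq, Submodule.map_top, range_subtype]
  refine ⟨fun a => ?_, ?_, by rwa [hspan], by rwa [hspan]⟩
  · rw [pow_succ', Module.End.mul_apply, hw]
    exact (hC (b a).2).1
  · have := b.linearIndependent.map' C.subtype C.ker_subtype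
    rwa [show C.subtype ∘ b = fun a => (X ^ k) (w a) from funext fun a => (hw a).symm] at this

theorem exists_isBlockFamily (X : Module.End K V) (k : ℕ) :
    ∃ (ι : Type v) (w : ι → V), IsBlockFamily X k w := by
  obtain ⟨C, hC, hd, hle⟩ := exists_socle_compl X k
  let b := Module.Basis.ofVectorSpace K C
  choose w hw using fun a => (hC (b a).2).2
  exact ⟨_, w, isBlockFamily_of_basis hC hd hle b hw⟩

/-- Block generators on which a functional `f` vanishes, for sizes other than the one of `f`. -/
theorem exists_isBlockFamily_of_ne {X : Module.End K V} {f : V →ₗ[K] K} {r : ℕ} {v : V}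
    (hv : (X ^ (r + 1)) v = 0) (hfv : f v = 1) (hr : ∀ y, (X ^ r) y = 0 → f y = 0) {k : ℕ}
    (hk : k ≠ r) :
    ∃ (ι : Type v) (w : ι → V), IsBlockFamily X k w ∧ ∀ a, f (w a) = 0 := by
  obtain ⟨C, hC, hd, hle⟩ := exists_socle_compl X k
  let b := Module.Basis.ofVectorSpace K C
  choose w hw using fun a => (hC (b a).2).2
  rcases lt_or_gt_of_ne hk with h | h
  -- For `k < r` the generators lie in `ker (X ^ r)`, where `f` vanishes.
  · have hB := isBlockFamily_of_basis hC hd hle b hw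
    refine ⟨_, w, hB, fun a => hr _ ?_⟩
    obtain ⟨d, rfl⟩ := Nat.exists_eq_add_of_le' (Nat.succ_le_of_lt h)
    rw [pow_add, Module.End.mul_apply, hB.pow_eq_zero, map_zero]
  -- For `k > r` the vector `v` is killed by `X ^ k`, so subtracting multiples of it does not affect
  -- the lifting property.
  · refine ⟨_, fun a => w a - f (w a) • v, isBlockFamily_of_basis hC hd hle b fun a => ?_,
      fun a => by simp [hfv]⟩
    obtain ⟨d, rfl⟩ := Nat.exists_eq_add_of_le' (Nat.succ_le_of_lt h)
    have : (X ^ (d + r.succ)) v = 0 := by rw [pow_add, Module.End.mul_apply, hv, map_zero]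
    rw [map_sub, map_smul, this, smul_zero, sub_zero, hw]

/-- Block generators of the size of a functional `f`, exactly one of which is not killed by `f`. -/
theorem exists_isBlockFamily_self {X : Module.End K V} {f : V →ₗ[K] K} {r : ℕ} {v : V}
    (hv : (X ^ (r + 1)) v = 0) (hfv : f v = 1) (hr : ∀ y, (X ^ r) y = 0 → f y = 0)
    (hf : ∀ y, f (X y) = 0) :
    ∃ (ι : Type v) (w : ι → V) (a₀ : ι), IsBlockFamily X r w ∧ f (w a₀) = 1 ∧
      ∀ a, a ≠ a₀ → f (w a) = 0 := by
  obtain ⟨C, hC, hd, hle⟩ := exists_socle_compl X r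
  obtain ⟨g, hg⟩ := (X ^ r).rangeRestrict.exists_rightInverse_of_surjective
    (LinearMap.range_rangeRestrict _)
  have hg' : ∀ y, (X ^ r) (g y) = y := fun y => congrArg Subtype.val (LinearMap.congr_fun hg y)
  -- Since `f` kills `ker (X ^ r)`, its value on a lift through `X ^ r` does not depend on the
  -- section `g`.
  let F : C →ₗ[K] K := f ∘ₗ g ∘ₗ inclusion (hC.trans inf_le_right)
  have hF : F ≠ 0 := by
    have hmem : (X ^ r) v ∈ C ⊔ socle X (r + 1) :=
      hle (pow_apply_mem_socle hv)
    obtain ⟨c, hc, s, ⟨-, y, rfl⟩, hcs⟩ := mem_sup.mp hmem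
    intro h0
    -- Here `X ^ r v = c + X ^ (r + 1) y`, so the argument of `f` lies in `ker (X ^ r)`; if `F` were
    -- zero this would give `f v = 0`.
    have h1 : f (v - X y - g (inclusion (hC.trans inf_le_right) ⟨c, hc⟩)) = 0 := by
      apply hr
      rw [map_sub, map_sub, hg', ← hcs, ← Module.End.mul_apply, ← pow_succ]
      simp
    have h2 : f (g (inclusion (hC.trans inf_le_right) ⟨c, hc⟩)) = 0 :=
      LinearMap.congr_fun h0 ⟨c, hc⟩
    rw [map_sub, map_sub, hf, h2, hfv] at h1
    simp at h1
  obtain ⟨ι, b, a₀, h1, h2⟩ := exists_basis_functional F hF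
  exact ⟨ι, fun a => g (inclusion (hC.trans inf_le_right) (b a)), a₀,
    isBlockFamily_of_basis hC hd hle b fun a => hg' _, h1, h2⟩

section Assemble

variable {X : Module.End K V} {n : ℕ} {ι : Fin n → Type v} {w : ∀ k, ι k → V}

/-- In a relation, treat the block sizes in increasing order: once the smaller ones are gone, the
terms of larger size lie in the next socle, which is disjoint from the span of the current ones. -/
theorem linearIndependent_socle (h : ∀ k : Fin n, IsBlockFamily X k (w k)) :
    LinearIndependent K fun i : Σ k, ι k => (X ^ (i.1 : ℕ)) (w i.1 i.2) := by
  classical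
  have hmem : ∀ (k : ℕ) (i : Σ k, ι k), k ≤ i.1 → (X ^ (i.1 : ℕ)) (w i.1 i.2) ∈ socle X k := by
    rintro k ⟨i, a⟩ hk
    obtain ⟨d, hd⟩ := Nat.exists_eq_add_of_le hk
    refine ⟨?_, (X ^ d) (w i a), ?_⟩
    · exact (pow_apply_mem_socle ((h i).pow_eq_zero a)).1
    · change _ = (X ^ (i : ℕ)) (w i a)
      change (i : ℕ) = k + d at hd
      rw [← Module.End.mul_apply, ← pow_add, hd]
  rw [linearIndependent_iff']
  intro S c hS
  have key : ∀ m : ℕ, ∀ i ∈ S, (i.1 : ℕ) = m → c i = 0 := by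
    intro m
    induction m using Nat.strong_induction_on with
    | _ m ih =>
    intro i₀ hi₀ him
    obtain ⟨k, a₀⟩ := i₀
    obtain rfl : (k : ℕ) = m := him
    set s : (Σ k, ι k) → V := fun i => (X ^ (i.1 : ℕ)) (w i.1 i.2) with hs
    have hsplit : ∑ i ∈ S with i.1 = k, c i • s i + ∑ i ∈ S with ¬ i.1 = k, c i • s i = 0 := by
      rw [Finset.sum_filter_add_sum_filter_not]; exact hS
    have hA : ∑ i ∈ S with i.1 = k, c i • s i ∈
        span K (Set.range fun a => (X ^ (k : ℕ)) (w k a)) := by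
      refine sum_mem fun i hi => smul_mem _ _ (subset_span ?_)
      obtain ⟨j, a⟩ := i
      obtain rfl : j = k := (Finset.mem_filter.mp hi).2
      exact ⟨a, rfl⟩
    have hB : ∑ i ∈ S with ¬ i.1 = k, c i • s i ∈ socle X (k + 1) := by
      refine sum_mem fun i hi => ?_
      obtain ⟨hiS, hik⟩ := Finset.mem_filter.mp hi
      rcases lt_or_gt_of_ne (fun h => hik (Fin.ext h) : (i.1 : ℕ) ≠ k) with hlt | hgt
      · rw [ih _ hlt i hiS rfl, zero_smul]; exact zero_mem _
      · exact smul_mem _ _ (hmem _ i hgt)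
    have h0 : ∑ i ∈ S with i.1 = k, c i • s i = 0 :=
      disjoint_def.mp (h k).disjoint _ hA (by
        rw [eq_neg_of_add_eq_zero_left hsplit]; exact neg_mem hB)
    have hinj : Function.Injective fun a : ι k => (⟨k, a⟩ : Σ k, ι k) := sigma_mk_injective
    have h1 : ∑ a ∈ S.preimage (fun a : ι k => (⟨k, a⟩ : Σ k, ι k)) hinj.injOn,
        c ⟨k, a⟩ • s ⟨k, a⟩ = 0 := by
      rw [Finset.sum_preimage' (fun a : ι k => (⟨k, a⟩ : Σ k, ι k)) S hinj.injOn
        (fun i => c i • s i), ← h0]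
      refine Finset.sum_congr (Finset.filter_congr fun i _ => ?_) fun _ _ => rfl
      constructor
      · rintro ⟨a, rfl⟩; rfl
      · rintro rfl; exact ⟨i.2, rfl⟩
    exact linearIndependent_iff'.mp (h k).indep _ (fun a => c ⟨k, a⟩) h1 a₀
      (Finset.mem_preimage.mpr hi₀)
  exact fun i hi => key _ i hi rfl

/-- The block generators and their images under the powers of `X` are linearly independent. -/
theorem linearIndependent_blocks {β : Type*} {len : β → ℕ} {w : β → V}
    (hlen : ∀ b, len b ≤ n) (hzero : ∀ b, (X ^ len b) (w b) = 0)
    (hind : LinearIndependent K fun b => (X ^ (len b - 1)) (w b)) :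
    LinearIndependent K fun i : Σ b, Fin (len b) => (X ^ (i.2 : ℕ)) (w i.1) := by
  classical
  rw [linearIndependent_iff']
  intro S c hS
  -- Here `d = len b - 1 - j` is the number of steps from `X ^ j w_b` to the end of its chain.
  -- Applying `X ^ d` kills the vectors with fewer steps left and sends those with exactly `d` to
  -- independent chain ends; coefficients with more steps left vanish by induction on `e = n - d`.
  have key : ∀ e d : ℕ, d + e = n → ∀ i ∈ S, len i.1 = (i.2 : ℕ) + d + 1 → c i = 0 := by
    intro e
    induction e using Nat.strong_induction_on with
    | _ e ih =>
    intro d hde i₀ hi₀ hi₀d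
    have h0 := congrArg (X ^ d) hS
    rw [map_sum, map_zero] at h0
    have h1 : ∑ i ∈ S with len i.1 = (i.2 : ℕ) + d + 1, c i • (X ^ (len i.1 - 1)) (w i.1) = 0 := by
      rw [Finset.sum_filter]
      refine Eq.trans ?_ h0
      refine Finset.sum_congr rfl fun i hi => ?_
      rw [map_smul, ← Module.End.mul_apply, ← pow_add]
      rcases lt_trichotomy (len i.1) ((i.2 : ℕ) + d + 1) with hlt | heq | hgt
      · rw [if_neg hlt.ne]
        obtain ⟨t, ht⟩ := Nat.exists_eq_add_of_le' (Nat.lt_succ_iff.mp hlt)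
        rw [add_comm d, ht, pow_add, Module.End.mul_apply, hzero, map_zero, smul_zero]
      · rw [if_pos heq]
        congr 3
        omega
      · rw [if_neg hgt.ne']
        have := hlen i.1
        rw [ih (n - (len i.1 - 1 - i.2)) (by omega) (len i.1 - 1 - i.2) (by omega) i hi (by omega),
          zero_smul]
    have hinj : Function.Injective
        fun i : {i : Σ b, Fin (len b) // len i.1 = (i.2 : ℕ) + d + 1} => i.1.1 := by
      rintro ⟨⟨b, j⟩, hj⟩ ⟨⟨b', j'⟩, hj'⟩ hb
      obtain rfl : b = b' := hb
      have : j = j' := Fin.ext (by simp only at hj hj'; omega)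
      rw [Subtype.mk.injEq, this]
    rw [← Finset.sum_subtype_eq_sum_filter] at h1
    exact linearIndependent_iff'.mp (hind.comp _ hinj) _ (fun i => c i.1) h1 ⟨i₀, hi₀d⟩
      (Finset.mem_subtype.mpr hi₀)
  intro i hi
  have := hlen i.1
  have := i.2.2
  exact key (n - (len i.1 - 1 - i.2)) (len i.1 - 1 - i.2) (by omega) i hi (by omega)

/-- Descending induction on `k` shows that each socle lies in `X ^ k` of the span. Ascending
induction then captures `ker (X ^ k)`: for `y` in `ker (X ^ (k + 1))`, the vector `X ^ k y` is in
the socle, so `y` differs from a vector of the span by an element of `ker (X ^ k)`. -/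
theorem span_blocks_eq_top (hX : X ^ n = 0) (h : ∀ k : Fin n, IsBlockFamily X k (w k)) :
    ⊤ ≤ span K (Set.range fun i : Σ b : (Σ k, ι k), Fin ((b.1 : ℕ) + 1) =>
      (X ^ (i.2 : ℕ)) (w i.1.1 i.1.2)) := by
  set Sp := span K (Set.range fun i : Σ b : (Σ k, ι k), Fin ((b.1 : ℕ) + 1) =>
      (X ^ (i.2 : ℕ)) (w i.1.1 i.1.2)) with hSp
  have hinv : Sp ≤ Sp.comap X := by
    rw [hSp, span_le]
    rintro _ ⟨⟨b, j⟩, rfl⟩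
    simp only [SetLike.mem_coe, mem_comap]
    rw [← Module.End.mul_apply, ← pow_succ']
    by_cases hj : (j : ℕ) + 1 < (b.1 : ℕ) + 1
    · exact subset_span ⟨⟨b, ⟨j + 1, hj⟩⟩, rfl⟩
    · have : (j : ℕ) + 1 = b.1 + 1 := by omega
      rw [this, (h b.1).pow_eq_zero]
      exact zero_mem _
  have hsoc : ∀ e k, k + e = n → socle X k ≤ Sp.map (X ^ k) := by
    intro e
    induction e with
    | zero =>
      rintro k rfl
      rintro _ ⟨-, y, rfl⟩
      rw [add_zero] at hX
      rw [hX]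
      exact zero_mem _
    | succ e ih =>
      intro k hk
      have hkn : k < n := by omega
      refine (h ⟨k, hkn⟩).le.trans (sup_le ?_ ?_)
      · rw [span_le]
        rintro _ ⟨a, rfl⟩
        refine ⟨w ⟨k, hkn⟩ a, subset_span ⟨⟨⟨⟨k, hkn⟩, a⟩, ⟨0, Nat.succ_pos _⟩⟩, ?_⟩, rfl⟩
        simp
      · refine (ih (k + 1) (by omega)).trans ?_
        rintro _ ⟨y, hy, rfl⟩
        exact ⟨X y, hinv hy, by rw [pow_succ]; rfl⟩
  have hker : ∀ k ≤ n, LinearMap.ker (X ^ k) ≤ Sp := by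
    intro k
    induction k with
    | zero =>
      intro _ y hy
      rw [show y = 0 from hy]
      exact zero_mem _
    | succ k ih =>
      intro hk y hy
      obtain ⟨y', hy', hyy'⟩ := hsoc (n - k) k (by omega)
        (pow_apply_mem_socle hy)
      have : y - y' ∈ Sp := ih (by omega) (by rw [LinearMap.mem_ker, map_sub, hyy', sub_self])
      simpa using add_mem this hy'
  intro y _
  exact hker n le_rfl (by rw [hX]; rfl)

end Assemble

/-- The conclusion of the Jordan decomposition of a nilpotent endomorphism: the vectors `X ^ j w_b`,
`j < len b`, form a basis. -/
structure IsJordanFamily (X : Module.End K V) (n : ℕ) {β : Type*} (len : β → ℕ) (w : β → V) :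
    Prop where
  pos : ∀ b, 1 ≤ len b
  le : ∀ b, len b ≤ n
  pow_eq_zero : ∀ b, (X ^ len b) (w b) = 0
  indep : LinearIndependent K fun i : Σ b, Fin (len b) => (X ^ (i.2 : ℕ)) (w i.1)
  span : ⊤ ≤ span K (Set.range fun i : Σ b, Fin (len b) => (X ^ (i.2 : ℕ)) (w i.1))

theorem isJordanFamily_of_blocks {X : Module.End K V} {n : ℕ} (hX : X ^ n = 0)
    {ι : Fin n → Type v} {w : ∀ k, ι k → V} (h : ∀ k : Fin n, IsBlockFamily X k (w k)) :
    IsJordanFamily X n (fun b : Σ k, ι k => (b.1 : ℕ) + 1) (fun b => w b.1 b.2) where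
  pos _ := Nat.succ_pos _
  le b := b.1.2
  pow_eq_zero b := (h b.1).pow_eq_zero b.2
  indep := linearIndependent_blocks (n := n) (β := Σ k, ι k) (len := fun b => (b.1 : ℕ) + 1)
    (w := fun b => w b.1 b.2) (fun b => b.1.2) (fun b => (h b.1).pow_eq_zero b.2)
    (by simpa only [Nat.add_sub_cancel] using linearIndependent_socle h)
  span := span_blocks_eq_top hX h

/-- Jordan decomposition of a nilpotent endomorphism `X` of a vector space of arbitrary dimension,
adapted to a functional `f` that vanishes on the range of `X`. -/
theorem exists_isJordanFamily {X : Module.End K V} {n : ℕ} (hX : X ^ n = 0) (f : V →ₗ[K] K)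
    (hf : ∀ y, f (X y) = 0) :
    ∃ (β : Type v) (len : β → ℕ) (w : β → V), IsJordanFamily X n len w ∧
      ((∃ b₀, len b₀ < n ∧ f (w b₀) = 1 ∧ ∀ b, b ≠ b₀ → f (w b) = 0) ∨
        ∀ b, len b < n → f (w b) = 0) := by
  classical
  by_cases hall : ∀ y, (X ^ (n - 1)) y = 0 → f y = 0
  · choose ι w h using fun k : Fin n => exists_isBlockFamily X k
    refine ⟨_, _, _, isJordanFamily_of_blocks (w := w) hX h, Or.inr fun b hb => hall _ ?_⟩
    obtain ⟨d, hd⟩ := Nat.exists_eq_add_of_le' (Nat.le_sub_one_of_lt hb)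
    rw [hd, pow_add, Module.End.mul_apply, (h b.1).pow_eq_zero, map_zero]
  · push Not at hall
    -- The least `u` for which `f` does not vanish on `ker (X ^ u)` is the length of the
    -- distinguished block; it is at most `n - 1`.
    have hex : ∃ u, ∃ y, (X ^ u) y = 0 ∧ f y ≠ 0 := ⟨_, hall⟩
    obtain ⟨y, hy, hfy⟩ := Nat.find_spec hex
    have hmin := fun m => Nat.find_min hex (m := m)
    have hle := Nat.find_min' hex hall
    generalize Nat.find hex = u at hy hmin hle
    cases u with
    | zero => exact absurd (by rw [show y = 0 from hy, map_zero]) hfy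
    | succ r =>
    have hr : ∀ y, (X ^ r) y = 0 → f y = 0 := fun y hy => by
      by_contra h
      exact hmin r (Nat.lt_succ_self r) ⟨y, hy, h⟩
    have hv : (X ^ (r + 1)) ((f y)⁻¹ • y) = 0 := by rw [map_smul, hy, smul_zero]
    have hfv : f ((f y)⁻¹ • y) = 1 := by simp [hfy]
    have hrn : r < n := by omega
    have hlev : ∀ k : Fin n, ∃ (ι : Type v) (w : ι → V), IsBlockFamily X k w ∧
        ((k : ℕ) ≠ r → ∀ a, f (w a) = 0) ∧
        ((k : ℕ) = r → ∃ a₀, f (w a₀) = 1 ∧ ∀ a, a ≠ a₀ → f (w a) = 0) := by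
      intro k
      by_cases hk : (k : ℕ) = r
      · obtain ⟨ι, w, a₀, h, h1, h2⟩ := exists_isBlockFamily_self hv hfv hr hf
        rw [hk]
        exact ⟨ι, w, h, fun h => absurd rfl h, fun _ => ⟨a₀, h1, h2⟩⟩
      · obtain ⟨ι, w, h, h1⟩ := exists_isBlockFamily_of_ne hv hfv hr hk
        exact ⟨ι, w, h, fun _ => h1, fun h => absurd h hk⟩
    choose ι w h h1 h2 using hlev
    obtain ⟨a₀, ha₀, ha⟩ := h2 ⟨r, hrn⟩ rfl
    refine ⟨_, _, _, isJordanFamily_of_blocks hX h, Or.inl ⟨⟨⟨r, hrn⟩, a₀⟩, ?_, ha₀, ?_⟩⟩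
    · change r + 1 < n
      omega
    · rintro ⟨k, a⟩ hne
      by_cases hk : (k : ℕ) = r
      · obtain rfl : k = ⟨r, hrn⟩ := Fin.ext hk
        exact ha a fun h => hne (by rw [h])
      · exact h1 k hk a

end Jordan

/-! ### Identities in characteristic `p`. -/

section Endomorphisms

variable {p : ℕ} [Fact p.Prime] {M : Type*} [AddCommGroup M] [Module (ZMod p) M]

open Polynomial in
theorem one_add_pow_prime (x : Module.End (ZMod p) M) : (1 + x) ^ p = 1 + x ^ p := by
  have h : (1 + X : (ZMod p)[X]) ^ p = 1 + X ^ p := by rw [add_pow_char, one_pow]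
  simpa using congrArg (aeval x) h

-- The quotient `((1 + X) ^ p - 1) / X` equals `X ^ (p - 1)`. With `1 + x` the action of `σ`, this
-- sum is the norm that governs `p`-th powers of the lifts of `σ`.
open Polynomial in
theorem geom_sum_one_add (x : Module.End (ZMod p) M) :
    ∑ j ∈ Finset.range p, (1 + x) ^ j = x ^ (p - 1) := by
  have h : ∑ j ∈ Finset.range p, (1 + X : (ZMod p)[X]) ^ j = X ^ (p - 1) := by
    apply mul_right_cancel₀ (X_ne_zero (R := ZMod p))
    have h1 := geom_sum_mul (1 + X : (ZMod p)[X]) p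
    rw [add_sub_cancel_left] at h1
    rw [h1, add_pow_char, one_pow, add_sub_cancel_left, ← pow_succ,
      Nat.sub_add_cancel (Fact.out : p.Prime).one_le]
  simpa using congrArg (aeval x) h

end Endomorphisms

/-! ### Products of Jordan blocks and the shift. -/

section Coord

variable {p : ℕ} {β : Type v} {len : β → ℕ}

/-- The product, over `b : β`, of the spaces `𝔽_p ^ (len b)`, realized as a space of functions
extended by zero. -/
def Coord (p : ℕ) {β : Type v} (len : β → ℕ) : Submodule (ZMod p) (β → ℕ → ZMod p) where
  carrier := {n | ∀ b j, len b ≤ j → n b j = 0}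
  zero_mem' := fun _ _ _ => rfl
  add_mem' := fun {x y} hx hy b j h => by
    rw [Pi.add_apply, Pi.add_apply, hx b j h, hy b j h, add_zero]
  smul_mem' := fun c x hx b j h => by
    rw [Pi.smul_apply, Pi.smul_apply, hx b j h, smul_zero]

/-- The shift operator, which is a product of nilpotent Jordan blocks. -/
def shift (p : ℕ) {β : Type v} (len : β → ℕ) : Module.End (ZMod p) (Coord p len) where
  toFun n := ⟨fun b j => n.1 b (j + 1), fun b j h => n.2 b (j + 1) (h.trans (Nat.le_succ j))⟩
  map_add' _ _ := rfl
  map_smul' _ _ := rfl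

theorem shift_apply (n : Coord p len) (b : β) (j : ℕ) :
    (shift p len n).1 b j = n.1 b (j + 1) := rfl

theorem shift_pow_apply (k : ℕ) (n : Coord p len) (b : β) (j : ℕ) :
    ((shift p len ^ k) n).1 b j = n.1 b (j + k) := by
  induction k generalizing n with
  | zero => rfl
  | succ k ih => rw [pow_succ, Module.End.mul_apply, ih, shift_apply]; rfl

theorem mem_range_shift_pow {k : ℕ} {n : Coord p len} :
    n ∈ LinearMap.range (shift p len ^ k) ↔ ∀ b j, len b ≤ j + k → n.1 b j = 0 := by
  constructor
  · rintro ⟨m, rfl⟩ b j h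
    rw [shift_pow_apply]
    exact m.2 b _ h
  · intro h
    refine ⟨⟨fun b j => if k ≤ j then n.1 b (j - k) else 0, fun b j hj => ?_⟩, ?_⟩
    · by_cases hk : k ≤ j
      · simp only [hk, if_true]
        exact h b _ (by omega)
      · simp [hk]
    · ext b j
      rw [shift_pow_apply]
      simp

theorem shift_eq_zero_iff {n : Coord p len} : shift p len n = 0 ↔ ∀ b j, n.1 b (j + 1) = 0 := by
  constructor
  · intro h b j
    rw [← shift_apply, h]
    rfl
  · intro h
    ext b j
    exact h b j

theorem shift_pow_eq_zero {k : ℕ} (h : ∀ b, len b ≤ k) : shift p len ^ k = 0 := by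
  ext n b j
  rw [shift_pow_apply]
  exact n.2 b _ ((h b).trans (Nat.le_add_left _ _))

theorem continuous_shift : Continuous (shift p len) := by
  refine Continuous.subtype_mk (continuous_pi fun b => continuous_pi fun j => ?_) _
  exact (continuous_apply_apply b (j + 1)).comp continuous_subtype_val

theorem isClosed_coord : IsClosed (Coord p len : Set (β → ℕ → ZMod p)) := by
  have : (Coord p len : Set (β → ℕ → ZMod p)) = ⋂ b, ⋂ j, ⋂ (_ : len b ≤ j), {n | n b j = 0} := by
    ext n
    simp only [Set.mem_iInter]
    rfl
  rw [this]
  refine isClosed_iInter fun b => isClosed_iInter fun j => isClosed_iInter fun _ => ?_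
  exact isClosed_eq (by fun_prop) continuous_const

instance [NeZero p] : CompactSpace (Coord p len) :=
  isCompact_iff_compactSpace.mp isClosed_coord.isCompact

open Classical in
/-- The first basis vector of the block `b₀`. -/
noncomputable def unitVec (p : ℕ) {β : Type v} (len : β → ℕ) (b₀ : β) (h : 1 ≤ len b₀) :
    Coord p len :=
  ⟨fun b j => if b = b₀ ∧ j = 0 then 1 else 0, fun b j hj => if_neg fun h' => by
    obtain ⟨rfl, rfl⟩ := h'
    omega⟩

theorem unitVec_apply_self {b₀ : β} (h : 1 ≤ len b₀) : (unitVec p len b₀ h).1 b₀ 0 = 1 := by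
  simp [unitVec]

theorem unitVec_apply_of_ne {b₀ : β} (h : 1 ≤ len b₀) {b : β} (hb : b ≠ b₀) (j : ℕ) :
    (unitVec p len b₀ h).1 b j = 0 := by
  simp [unitVec, hb]

theorem shift_unitVec {b₀ : β} (h : 1 ≤ len b₀) : shift p len (unitVec p len b₀ h) = 0 := by
  rw [shift_eq_zero_iff]
  intro b j
  simp [unitVec]

theorem eq_unitVec {b₀ : β} (h : 1 ≤ len b₀) {n : Coord p len} (h1 : n.1 b₀ 0 = 1)
    (h2 : ∀ b, b ≠ b₀ → n.1 b 0 = 0) (h3 : ∀ b j, n.1 b (j + 1) = 0) :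
    n = unitVec p len b₀ h := by
  ext b j
  cases j with
  | zero =>
    by_cases hb : b = b₀
    · subst hb
      rw [h1, unitVec_apply_self]
    · rw [h2 b hb, unitVec_apply_of_ne h hb]
  | succ j =>
    rw [h3]
    simp [unitVec]

end Coord

/-! ### Reduction of a profinite module to a product of Jordan blocks. -/

section Coordinatization

variable {p : ℕ} [Fact p.Prime] {M : Type v} [AddCommGroup M] [Module (ZMod p) M]
  [TopologicalSpace M] [IsTopologicalAddGroup M] [CompactSpace M] [TotallyDisconnectedSpace M]

/-- A profinite `𝔽_p`-vector space with a continuous endomorphism `x` such that `x ^ p = 0` is a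
product of nilpotent Jordan blocks, and a given vector killed by `x` may be assumed to be a basis
vector unless it lies in the image of `x ^ (p - 1)`. -/
theorem exists_coord_equiv (x : Module.End (ZMod p) M) (hxc : Continuous x) (hxp : x ^ p = 0)
    (z : M) (hz : x z = 0) :
    ∃ (β : Type v) (len : β → ℕ) (hpos : ∀ b, 1 ≤ len b) (_ : ∀ b, len b ≤ p)
      (e : Coord p len ≃ₗ[ZMod p] M), Continuous e ∧ (∀ n, x (e n) = e (shift p len n)) ∧
      ((∃ b₀, len b₀ < p ∧ e (unitVec p len b₀ (hpos b₀)) = z) ∨ ∃ y, (x ^ (p - 1)) y = z) := by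
  let xc : M →L[ZMod p] M := ⟨x, hxc⟩
  -- The transpose of `x` on the continuous dual; below, `f` is evaluation at `z`, which vanishes on
  -- the range of `X` because `x z = 0`.
  let X : Module.End (ZMod p) (M →L[ZMod p] ZMod p) :=
    { toFun := fun χ => χ.comp xc
      map_add' := fun _ _ => rfl
      map_smul' := fun _ _ => rfl }
  have hX : ∀ (j : ℕ) χ m, (X ^ j) χ m = χ ((x ^ j) m) := by
    intro j
    induction j with
    | zero => intro χ m; rfl
    | succ j ih =>
      intro χ m
      rw [pow_succ', Module.End.mul_apply, pow_succ, Module.End.mul_apply, ← ih]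
      rfl
  have hXp : X ^ p = 0 := by
    ext χ m
    rw [hX, hxp]
    simp
  let f : (M →L[ZMod p] ZMod p) →ₗ[ZMod p] ZMod p :=
    { toFun := fun χ => χ z
      map_add' := fun _ _ => rfl
      map_smul' := fun _ _ => rfl }
  obtain ⟨β, len, w, hJ, hw⟩ := exists_isJordanFamily hXp f (fun χ => by
    change χ (x z) = 0
    rw [hz, map_zero])
  let E : M →ₗ[ZMod p] Coord p len :=
    { toFun := fun m => ⟨fun b j => w b ((x ^ j) m), fun b j hj => by
        obtain ⟨d, rfl⟩ := Nat.exists_eq_add_of_le' hj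
        change w b ((x ^ (d + len b)) m) = 0
        rw [← hX, pow_add, Module.End.mul_apply, hJ.pow_eq_zero, map_zero]
        rfl⟩
      map_add' := fun m m' => by ext b j; simp
      map_smul' := fun c m => by ext b j; simp }
  have hE : ∀ m b j, (E m).1 b j = w b ((x ^ j) m) := fun _ _ _ => rfl
  have hEc : Continuous E := by
    refine Continuous.subtype_mk (continuous_pi fun b => continuous_pi fun j => ?_) _
    have : (fun m => w b ((x ^ j) m)) = (X ^ j) (w b) := funext fun m => (hX j (w b) m).symm
    rw [this]
    exact ((X ^ j) (w b)).continuous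
  -- The coordinates in `E` are the values of the Jordan basis of the dual: spanning gives
  -- injectivity, independence together with compactness gives surjectivity.
  have hEb : Function.Bijective E := by
    constructor
    · intro m m' h
      refine eq_of_forall_character_eq hJ.span fun i => ?_
      rw [hX, hX, ← hE, ← hE, h]
    · intro n
      obtain ⟨m, hm⟩ := exists_forall_character_eq hJ.indep fun i => n.1 i.1 i.2
      refine ⟨m, ?_⟩
      ext b j
      by_cases hj : j < len b
      · rw [hE, ← hX]
        exact hm ⟨b, ⟨j, hj⟩⟩
      · rw [(E m).2 b j (not_lt.mp hj), n.2 b j (not_lt.mp hj)]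
  let e : M ≃ₗ[ZMod p] Coord p len := LinearEquiv.ofBijective E hEb
  have he : ∀ m, e m = E m := fun _ => rfl
  have hEx : ∀ m, E (x m) = shift p len (E m) := by
    intro m
    ext b j
    rw [hE, shift_apply, hE, pow_succ, Module.End.mul_apply]
  have hEz : ∀ b j, (E z).1 b (j + 1) = 0 := by
    intro b j
    rw [hE, pow_succ, Module.End.mul_apply, hz, map_zero, map_zero]
  have hesymm : ∀ n, E (e.symm n) = n := fun n => e.apply_symm_apply n
  refine ⟨β, len, hJ.pos, hJ.le, e.symm, ?_, ?_, ?_⟩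
  · exact (Continuous.homeoOfEquivCompactToT2 (f := e.toEquiv) hEc).symm.continuous
  · intro n
    apply e.injective
    rw [he, hEx, hesymm, LinearEquiv.apply_symm_apply]
  · rcases hw with ⟨b₀, hb₀, h1, h2⟩ | h
    · refine Or.inl ⟨b₀, hb₀, ?_⟩
      rw [LinearEquiv.symm_apply_eq]
      exact (eq_unitVec (hJ.pos b₀) h1 h2 hEz).symm
    · right
      have hp := (Fact.out : p.Prime).one_le
      -- Only the zeroth coordinates of blocks of length `p` can be nonzero in `E z`, and these are
      -- reached by `p - 1` shifts.
      have hmem : E z ∈ LinearMap.range (shift p len ^ (p - 1)) := by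
        rw [mem_range_shift_pow]
        intro b j hj
        cases j with
        | zero => exact h b (by omega)
        | succ j => exact hEz b j
      obtain ⟨n, hn⟩ := hmem
      refine ⟨e.symm n, e.injective ?_⟩
      have hpow : ∀ (k : ℕ) m, E ((x ^ k) m) = (shift p len ^ k) (E m) := by
        intro k
        induction k with
        | zero => intro m; rfl
        | succ k ih =>
          intro m
          rw [pow_succ', Module.End.mul_apply, hEx, ih, pow_succ', Module.End.mul_apply]
      rw [he, hpow, hesymm, hn, he]

end Coordinatization

/-! ### Extensions of `ℤ/p` and their presentations. -/

/-- The data describing an extension of `ℤ/p` by an elementary abelian group `M`: the generator of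
`ℤ/p` acts on `M` as `1 + op`, and `z` is the `p`-th power of a lift of that generator. -/
structure CyclicDatum (p : ℕ) (M : Type v) [AddCommGroup M] [Module (ZMod p) M]
    [TopologicalSpace M] where
  op : Module.End (ZMod p) M
  op_pow : op ^ p = 0
  op_cont : Continuous op
  z : M
  op_z : op z = 0

/-- `T` is an extension of `ℤ/p` by `M` described by `D`. -/
structure Presentation {p : ℕ} {M : Type v} [AddCommGroup M] [Module (ZMod p) M]
    [TopologicalSpace M] (D : CyclicDatum p M) (T : Type v) [Group T] [TopologicalSpace T] where
  φ : M → T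
  σ : T
  map_add : ∀ m n, φ (m + n) = φ m * φ n
  cont : Continuous φ
  inj : Function.Injective φ
  conj : ∀ m, σ * φ m = φ (m + D.op m) * σ
  pow_eq : σ ^ p = φ D.z
  ne_gen : ∀ m, φ m ≠ σ
  exists_eq : ∀ t, ∃ m, ∃ k : ℕ, t = φ m * σ ^ k

namespace Presentation

variable {p : ℕ} {M : Type v} [AddCommGroup M] [Module (ZMod p) M]
    [TopologicalSpace M] {D : CyclicDatum p M} {T : Type v} [Group T] [TopologicalSpace T]
    (P : Presentation D T)

/-- Transport of a presentation along an isomorphism of the kernels. -/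
def comp {M' : Type v} [AddCommGroup M'] [Module (ZMod p) M'] [TopologicalSpace M']
    {D' : CyclicDatum p M'} (e : M' ≃ₗ[ZMod p] M) (hc : Continuous e)
    (he : ∀ m, D.op (e m) = e (D'.op m)) (hz : e D'.z = D.z) : Presentation D' T where
  φ m := P.φ (e m)
  σ := P.σ
  map_add m n := by rw [_root_.map_add, P.map_add]
  cont := P.cont.comp hc
  inj := P.inj.comp e.injective
  conj m := by rw [P.conj, _root_.map_add, he]
  pow_eq := by rw [P.pow_eq, hz]
  ne_gen m := P.ne_gen _
  exists_eq t := by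
    obtain ⟨m, k, rfl⟩ := P.exists_eq t
    exact ⟨e.symm m, k, by simp⟩

/-- The embedding of the kernel, as a homomorphism. -/
def hom : Multiplicative M →* T :=
  MonoidHom.mk' (fun m => P.φ m.toAdd) fun _ _ => P.map_add _ _

theorem map_zero : P.φ 0 = 1 := P.hom.map_one

theorem map_neg (m : M) : P.φ (-m) = (P.φ m)⁻¹ := P.hom.map_inv (Multiplicative.ofAdd m)

theorem map_nsmul (k : ℕ) (m : M) : P.φ (k • m) = P.φ m ^ k :=
  P.hom.map_pow (Multiplicative.ofAdd m) k

theorem commute (m n : M) : P.φ m * P.φ n = P.φ n * P.φ m := by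
  rw [← P.map_add, ← P.map_add, add_comm]

theorem gen_pow_mul (k : ℕ) (m : M) :
    P.σ ^ k * P.φ m = P.φ (((1 + D.op) ^ k) m) * P.σ ^ k := by
  induction k generalizing m with
  | zero => simp
  | succ k ih =>
    rw [pow_succ, mul_assoc, P.conj, ← mul_assoc, ih, pow_succ (1 + D.op), Module.End.mul_apply,
      mul_assoc]
    rfl

theorem mul_pow_eq (m : M) (a k : ℕ) :
    (P.φ m * P.σ ^ a) ^ k =
      P.φ ((∑ j ∈ Finset.range k, ((1 + D.op) ^ a) ^ j) m) * P.σ ^ (a * k) := by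
  induction k with
  | zero => simp [P.map_zero]
  | succ k ih =>
    rw [pow_succ, ih, mul_assoc, ← mul_assoc (P.σ ^ (a * k)), P.gen_pow_mul, mul_assoc,
      ← mul_assoc (P.φ _) (P.φ _), ← P.map_add, ← pow_add, Finset.sum_range_succ,
      LinearMap.add_apply, ← pow_mul, mul_add, mul_one]

/-- If the `p`-th power of the lift of the generator is in the image of `op ^ (p - 1)`, another lift
has order `p`. -/
def splitting [Fact p.Prime] {D' : CyclicDatum p M}
    (hop : D'.op = D.op) (y : M) (hy : (D.op ^ (p - 1)) y = D.z) (hz : D'.z = 0) :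
    Presentation D' T where
  φ := P.φ
  σ := P.φ (-y) * P.σ
  map_add := P.map_add
  cont := P.cont
  inj := P.inj
  conj m := by rw [mul_assoc, P.conj, ← mul_assoc, P.commute, hop, mul_assoc]
  pow_eq := by
    -- The `p`-th power of the new generator is the norm of `-y` plus `z`, that is `-x ^ (p - 1) y +
    -- z = 0`.
    have h := P.mul_pow_eq (-y) 1 p
    rw [pow_one, pow_one, geom_sum_one_add, one_mul, P.pow_eq, ← P.map_add, _root_.map_neg, hy,
      neg_add_cancel] at h
    rw [h, hz]
  ne_gen m h := P.ne_gen (y + m) (by rw [P.map_add, h, P.map_neg, mul_inv_cancel_left])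
  exists_eq t := by
    obtain ⟨m, k, rfl⟩ := P.exists_eq t
    have h := P.mul_pow_eq (-y) 1 k
    rw [one_mul, pow_one] at h
    refine ⟨m - (∑ j ∈ Finset.range k, ((1 + D.op) ^ 1) ^ j : Module.End (ZMod p) M) (-y), k, ?_⟩
    rw [h, ← mul_assoc, ← P.map_add, sub_add_cancel]

end Presentation

/-- The datum of a product of Jordan blocks. -/
def coordDatum {p : ℕ} {β : Type v} {len : β → ℕ} (hlen : ∀ b, len b ≤ p) (z : Coord p len)
    (hz : shift p len z = 0) : CyclicDatum p (Coord p len) where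
  op := shift p len
  op_pow := shift_pow_eq_zero hlen
  op_cont := continuous_shift
  z := z
  op_z := hz

/-! ### From a `T`-group to a presentation. -/

section Structure

variable {p : ℕ} {T : Type v} [Group T] [TopologicalSpace T] [IsTopologicalGroup T]
  [CompactSpace T] [TotallyDisconnectedSpace T]

/-- A closed subgroup is the intersection of the open subgroups containing it, so `N` lies in a
proper open one and equals it by maximality. -/
theorem IsMaximalClosed.isOpen {N : Subgroup T} (hN : IsMaximalClosed N) :
    IsOpen (N : Set T) := by
  have hN' : (⟨N, hN.prop.1⟩ : ClosedSubgroup T).toSubgroup = _ :=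
    ProfiniteGrp.closedSubgroup_eq_sInf_open _
  obtain ⟨H, hH, hNH, hne⟩ : ∃ H : Subgroup T, IsOpen (H : Set T) ∧ N ≤ H ∧ H ≠ ⊤ := by
    by_contra! h
    refine hN.prop.2 (hN'.trans (sInf_eq_top.mpr fun H hH => h H hH.1 hH.2))
  have := hN.eq_of_le ⟨H.isClosed_of_isOpen hH, hne⟩ hNH
  rwa [this]

theorem IsMaximalClosed.isCoatom {N : Subgroup T} (hN : IsMaximalClosed N) : IsCoatom N := by
  refine ⟨hN.prop.2, fun H hH => ?_⟩
  by_contra hne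
  exact hH.not_ge (hN.le_of_ge ⟨H.isClosed_of_isOpen (Subgroup.isOpen_mono hH.le hN.isOpen), hne⟩
    hH.le)

/-- Modulo an open normal subgroup inside `N`, the group is a finite `p`-group, hence nilpotent, and
maximal subgroups of nilpotent groups are normal. -/
theorem IsMaximalClosed.normal [Fact p.Prime]
    (hT : ∀ U : OpenNormalSubgroup T, IsPGroup p (T ⧸ U.toSubgroup)) {N : Subgroup T}
    (hN : IsMaximalClosed N) : N.Normal := by
  obtain ⟨U, hU⟩ := ProfiniteGrp.exist_openNormalSubgroup_sub_open_nhds_of_one hN.isOpen N.one_mem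
  have hUN : U.toSubgroup ≤ N := hU
  have : Finite (T ⧸ U.toSubgroup) := Subgroup.quotient_finite_of_isOpen _ U.isOpen'
  have hnil : Group.IsNilpotent (T ⧸ U.toSubgroup) := (hT U).isNilpotent
  have hker : (QuotientGroup.mk' U.toSubgroup).ker ≤ N := by rwa [QuotientGroup.ker_mk']
  have hco : IsCoatom (N.map (QuotientGroup.mk' U.toSubgroup)) := by
    have hcm : (N.map (QuotientGroup.mk' U.toSubgroup)).comap
        (QuotientGroup.mk' U.toSubgroup) = N :=
      Subgroup.comap_map_eq_self hker
    refine ⟨fun h => ?_, fun H hH => ?_⟩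
    · rw [h, Subgroup.comap_top] at hcm
      exact hN.prop.2 hcm.symm
    · have hlt : N < H.comap (QuotientGroup.mk' U.toSubgroup) := by
        conv_lhs => rw [← hcm]
        exact (Subgroup.comap_lt_comap_of_surjective (QuotientGroup.mk'_surjective _)).mpr hH
      have := hN.isCoatom.2 _ hlt
      rw [← Subgroup.map_comap_eq_self_of_surjective (QuotientGroup.mk'_surjective _) H, this,
        Subgroup.map_top_of_surjective _ (QuotientGroup.mk'_surjective _)]
  have hnorm := Subgroup.NormalizerCondition.normal_of_coatom _
    Group.normalizerCondition_of_isNilpotent hco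
  rw [← Subgroup.comap_map_eq_self hker]
  exact hnorm.comap _

/-- For `s` outside `N`, take the last of `s, s ^ p, s ^ (p ^ 2), ...` before the sequence first
enters `N`. -/
theorem IsMaximalClosed.exists_pow_mem [Fact p.Prime]
    (hT : ∀ U : OpenNormalSubgroup T, IsPGroup p (T ⧸ U.toSubgroup)) {N : Subgroup T}
    (hN : IsMaximalClosed N) : ∃ σ, σ ∉ N ∧ σ ^ p ∈ N := by
  classical
  obtain ⟨U, hU⟩ := ProfiniteGrp.exist_openNormalSubgroup_sub_open_nhds_of_one hN.isOpen N.one_mem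
  obtain ⟨s, hs⟩ : ∃ s, s ∉ N := by
    by_contra! h
    exact hN.prop.2 (Subgroup.eq_top_iff' N |>.mpr h)
  have hex : ∃ k, s ^ p ^ k ∈ N := by
    obtain ⟨k, hk⟩ := hT U (QuotientGroup.mk s)
    rw [← QuotientGroup.mk_pow, QuotientGroup.eq_one_iff] at hk
    exact ⟨k, hU hk⟩
  have hmem := Nat.find_spec hex
  have hmin := fun m => Nat.find_min hex (m := m)
  generalize Nat.find hex = k at hmem hmin
  cases k with
  | zero => exact absurd (by simpa using hmem) hs
  | succ k => exact ⟨s ^ p ^ k, hmin k (Nat.lt_succ_self k), by rwa [← pow_mul, ← pow_succ]⟩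

theorem IsMaximalClosed.exists_eq_mul_pow [Fact p.Prime] {N : Subgroup T} [N.Normal]
    (hN : IsMaximalClosed N) {σ : T} (hσ : σ ∉ N) (hσp : σ ^ p ∈ N) (t : T) :
    ∃ n ∈ N, ∃ k : ℕ, t = n * σ ^ k := by
  have htop : N ⊔ Subgroup.zpowers σ = ⊤ := by
    refine hN.isCoatom.2 _ (lt_of_le_of_ne le_sup_left fun h => hσ ?_)
    rw [h]
    exact Subgroup.mem_sup_right (Subgroup.mem_zpowers σ)
  obtain ⟨n, hn, _, ⟨i, rfl⟩, rfl⟩ :=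
    Subgroup.mem_sup_of_normal_left.mp (show t ∈ N ⊔ Subgroup.zpowers σ by rw [htop]; trivial)
  have hp : (p : ℤ) ≠ 0 := by exact_mod_cast (Fact.out : p.Prime).ne_zero
  refine ⟨n * (σ ^ p) ^ (i / p), N.mul_mem hn (N.zpow_mem hσp _), (i % p).toNat, ?_⟩
  have h1 : σ ^ (i % p).toNat = σ ^ (i % p) := by
    rw [← zpow_natCast, Int.toNat_of_nonneg (Int.emod_nonneg _ hp)]
  change n * σ ^ i = _
  rw [h1, mul_assoc, ← zpow_natCast σ p, ← zpow_mul, ← zpow_add, Int.mul_ediv_add_emod]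

open scoped IsMulCommutative in
/-- A group with an open elementary abelian normal subgroup of index `p` is presented by a datum
on that subgroup. -/
theorem IsMaximalClosed.exists_presentation [Fact p.Prime] {N : Subgroup T} [N.Normal]
    [IsMulCommutative N] [Module (ZMod p) (Additive N)] (hN : IsMaximalClosed N)
    {σ : T} (hσ : σ ∉ N) (hσp : σ ^ p ∈ N) :
    ∃ D : CyclicDatum p (Additive N), Nonempty (Presentation D T) := by
  let τ : Module.End (ZMod p) (Additive N) :=
    (MonoidHom.toAdditive (MulAut.conjNormal σ : N ≃* N).toMonoidHom).toZModLinearMap p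
  have hτ : ∀ m, ((τ m).toMul : T) = σ * (m.toMul : T) * σ⁻¹ := fun m =>
    MulAut.conjNormal_apply σ m.toMul
  have hτk : ∀ (k : ℕ) m, (((τ ^ k) m).toMul : T) = σ ^ k * (m.toMul : T) * (σ ^ k)⁻¹ := by
    intro k
    induction k with
    | zero => intro m; simp
    | succ k ih =>
      intro m
      rw [pow_succ', Module.End.mul_apply, hτ, ih, pow_succ']
      group
  have hcomm : ∀ a ∈ N, ∀ b ∈ N, a * b = b * a := fun a ha b hb =>
    congrArg Subtype.val (mul_comm (⟨a, ha⟩ : N) ⟨b, hb⟩)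
  have hτp : τ ^ p = 1 := by
    ext m
    rw [hτk, hcomm _ hσp _ m.toMul.2, mul_inv_cancel_right]
    rfl
  have hτc : Continuous τ := by
    have h : Continuous fun m : N => (⟨σ * m * σ⁻¹, Subgroup.Normal.conj_mem ‹_› _ m.2 σ⟩ : N) :=
      Continuous.subtype_mk (by fun_prop) _
    refine (continuous_ofMul.comp (h.comp continuous_toMul)).congr fun m => ?_
    exact congrArg Additive.ofMul (Subtype.ext (hτ m).symm)
  let D : CyclicDatum p (Additive N) :=
    { op := τ - 1
      op_pow := by
        -- `τ ^ p = 1` because `σ ^ p` lies in the abelian group `N`; in characteristic `p` this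
        -- reads `(τ - 1) ^ p = 0`.
        have := one_add_pow_prime (τ - 1)
        rw [add_sub_cancel, hτp] at this
        exact left_eq_add.mp this
      op_cont := hτc.sub continuous_id
      z := Additive.ofMul ⟨σ ^ p, hσp⟩
      op_z := by
        rw [LinearMap.sub_apply, sub_eq_zero]
        refine congrArg Additive.ofMul (Subtype.ext ((hτ _).trans ?_))
        change σ * σ ^ p * σ⁻¹ = σ ^ p
        rw [← pow_succ', pow_succ, mul_inv_cancel_right] }
  refine ⟨D, ⟨⟨fun m => (m.toMul : T), σ, fun _ _ => rfl, ?_, ?_, ?_, rfl, ?_, ?_⟩⟩⟩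
  · exact continuous_subtype_val.comp continuous_toMul
  · exact fun a b h => congrArg Additive.ofMul (Subtype.ext h)
  · intro m
    have : m + D.op m = τ m := add_sub_cancel m (τ m)
    rw [this, hτ]
    group
  · intro m h
    exact hσ (h ▸ m.toMul.2)
  · intro t
    obtain ⟨n, hn, k, rfl⟩ := hN.exists_eq_mul_pow hσ hσp t
    exact ⟨Additive.ofMul ⟨n, hn⟩, k, rfl⟩

end Structure

open scoped IsMulCommutative in
/-- Every `T`-group is presented by a datum of Jordan blocks. -/
theorem IsTGroup.exists_presentation {p : ℕ} [Fact p.Prime] {T : ProfiniteGrp.{v}}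
    (hT : IsTGroup p T) :
    ∃ (β : Type v) (len : β → ℕ) (hpos : ∀ b, 1 ≤ len b) (hlen : ∀ b, len b ≤ p),
      Nonempty (Presentation (coordDatum (len := len) hlen 0 (map_zero _)) T) ∨
      ∃ b₀, len b₀ < p ∧
        Nonempty (Presentation (coordDatum hlen _ (shift_unitVec (hpos b₀))) T) := by
  obtain ⟨N, hN, hcomm, hexp⟩ := hT.exists_maximal
  have hnormal : N.Normal := hN.normal hT.proP
  obtain ⟨σ, hσ, hσp⟩ := hN.exists_pow_mem hT.proP
  have : IsMulCommutative N :=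
    ⟨⟨fun a b => Subtype.ext (hcomm a a.2 b b.2)⟩⟩
  let _ : Module (ZMod p) (Additive N) := AddCommGroup.zmodModule fun m : Additive N =>
    congrArg Additive.ofMul (Subtype.ext (hexp m.toMul m.toMul.2) : m.toMul ^ p = 1)
  have : CompactSpace (Additive N) := isCompact_iff_compactSpace.mp hN.prop.1.isCompact
  have : TotallyDisconnectedSpace (Additive N) :=
    inferInstanceAs (TotallyDisconnectedSpace N)
  obtain ⟨D, ⟨P⟩⟩ := hN.exists_presentation hσ hσp
  obtain ⟨β, len, hpos, hlen, e, hec, he, h⟩ :=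
    exists_coord_equiv D.op D.op_cont D.op_pow D.z D.op_z
  refine ⟨β, len, hpos, hlen, ?_⟩
  rcases h with ⟨b₀, hb₀, hz⟩ | ⟨y, hy⟩
  · exact Or.inr ⟨b₀, hb₀, ⟨P.comp e hec he hz⟩⟩
  · let D₀ : CyclicDatum p (Additive N) :=
      { op := D.op, op_pow := D.op_pow, op_cont := D.op_cont, z := 0, op_z := D.op.map_zero }
    exact Or.inl ⟨(P.splitting (D' := D₀) rfl y hy rfl).comp e hec he e.map_zero⟩

/-! ### Central series, centre and invariants in terms of the datum. -/

section Ranges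

variable {p : ℕ} {M : Type*} [AddCommGroup M] [Module (ZMod p) M]

theorem range_pow_antitone (x : Module.End (ZMod p) M) {k l : ℕ} (h : k ≤ l) :
    LinearMap.range (x ^ l) ≤ LinearMap.range (x ^ k) := by
  obtain ⟨d, rfl⟩ := Nat.exists_eq_add_of_le h
  rintro _ ⟨m, rfl⟩
  exact ⟨(x ^ d) m, by rw [pow_add]; rfl⟩

theorem exists_one_add_pow_eq (x : Module.End (ZMod p) M) (a : ℕ) :
    ∃ q : Module.End (ZMod p) M, Commute x q ∧ (1 + x) ^ a = 1 + x * q := by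
  refine ⟨∑ j ∈ Finset.range a, (1 + x) ^ j, ?_, ?_⟩
  · exact Commute.sum_right _ _ _ fun j _ =>
      ((Commute.one_right x).add_right (Commute.refl x)).pow_right j
  · have := mul_geom_sum (1 + x) a
    rw [add_sub_cancel_left] at this
    rw [this, add_sub_cancel]

theorem one_add_pow_sub_mem (x : Module.End (ZMod p) M) (a : ℕ) {k : ℕ} {m : M}
    (hm : m ∈ LinearMap.range (x ^ k)) :
    ((1 + x) ^ a) m - m ∈ LinearMap.range (x ^ (k + 1)) := by
  obtain ⟨q, hq, h⟩ := exists_one_add_pow_eq x a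
  obtain ⟨y, rfl⟩ := hm
  refine ⟨q y, ?_⟩
  rw [h, LinearMap.add_apply, Module.End.one_apply, add_sub_cancel_left, ← Module.End.mul_apply,
    ← Module.End.mul_apply, pow_succ', mul_assoc, mul_assoc, (hq.pow_left k).eq]

/-- With `(1 + x) ^ a = 1 + x * q` and `q` commuting with `x`, the norm is `(x * q) ^ (p - 1)`. -/
theorem geom_sum_one_add_pow_mem [Fact p.Prime] (x : Module.End (ZMod p) M) (a : ℕ) (m : M) :
    (∑ j ∈ Finset.range p, ((1 + x) ^ a) ^ j : Module.End (ZMod p) M) m ∈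
      LinearMap.range (x ^ (p - 1)) := by
  obtain ⟨q, hq, h⟩ := exists_one_add_pow_eq x a
  rw [h, geom_sum_one_add, hq.mul_pow]
  exact ⟨(q ^ (p - 1)) m, rfl⟩

end Ranges

theorem isClosed_range_pow {p : ℕ} {M : Type*} [AddCommGroup M] [Module (ZMod p) M]
    [TopologicalSpace M] [CompactSpace M] [T2Space M] {x : Module.End (ZMod p) M}
    (hx : Continuous x) (k : ℕ) : IsClosed (LinearMap.range (x ^ k) : Set M) := by
  have h : Continuous (x ^ k) := by
    rw [Module.End.coe_pow]
    exact hx.iterate k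
  exact (isCompact_range h).isClosed

theorem uInv_eq_of_isGreatest {p : ℕ} {T : Type v} [Group T] [TopologicalSpace T]
    [IsTopologicalGroup T] {u : ℕ}
    (h : IsGreatest {i : ℕ | 1 ≤ i ∧ i ≤ p ∧ powerSubgroup p T ≤ centralSeries T i} u) :
    uInv p T = u := h.csSup_eq

namespace Presentation

open scoped commutatorElement

variable {p : ℕ} {M : Type v} [AddCommGroup M] [Module (ZMod p) M] [TopologicalSpace M]
  {D : CyclicDatum p M} {T : Type v} [Group T] [TopologicalSpace T] (P : Presentation D T)

/-- The image in `T` of a subspace of the kernel. -/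
def image (S : Submodule (ZMod p) M) : Subgroup T where
  carrier := P.φ '' S
  one_mem' := ⟨0, S.zero_mem, P.map_zero⟩
  mul_mem' := by
    rintro _ _ ⟨m, hm, rfl⟩ ⟨n, hn, rfl⟩
    exact ⟨m + n, S.add_mem hm hn, P.map_add m n⟩
  inv_mem' := by
    rintro _ ⟨m, hm, rfl⟩
    exact ⟨-m, S.neg_mem hm, P.map_neg m⟩

theorem φ_mem_image {S : Submodule (ZMod p) M} {m : M} : P.φ m ∈ P.image S ↔ m ∈ S :=
  P.inj.mem_set_image

theorem image_mono {S S' : Submodule (ZMod p) M} (h : S ≤ S') : P.image S ≤ P.image S' :=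
  Set.image_mono h

theorem isClosed_image [CompactSpace M] [T2Space T] {S : Submodule (ZMod p) M}
    (hS : IsClosed (S : Set M)) : IsClosed (P.image S : Set T) :=
  (hS.isCompact.image P.cont).isClosed

theorem mul_mul_mul (m n : M) (a b : ℕ) :
    (P.φ m * P.σ ^ a) * (P.φ n * P.σ ^ b) =
      P.φ (m + ((1 + D.op) ^ a) n) * P.σ ^ (a + b) := by
  rw [mul_assoc, ← mul_assoc (P.σ ^ a), P.gen_pow_mul, P.map_add, pow_add]
  simp only [mul_assoc]

/-- The products `g * h` and `h * g` end in the same power of `σ`, so that `z` plays no role in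
commutators. -/
theorem commutator_eq (m n : M) (a b : ℕ) :
    ⁅P.φ m * P.σ ^ a, P.φ n * P.σ ^ b⁆ =
      P.φ ((((1 + D.op) ^ a) n - n) - (((1 + D.op) ^ b) m - m)) := by
  have h : ∀ g h : T, ⁅g, h⁆ = (g * h) * (h * g)⁻¹ := fun g h => by
    rw [commutatorElement_def, mul_inv_rev, mul_assoc (g * h)]
  rw [h, P.mul_mul_mul, P.mul_mul_mul, add_comm b a, mul_inv_rev, ← mul_assoc,
    mul_inv_cancel_right, ← P.map_neg, ← P.map_add]
  congr 1
  abel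

theorem commutator_gen (m : M) : ⁅P.φ m, P.σ⁆ = P.φ (-D.op m) := by
  have h := P.commutator_eq m 0 0 1
  rw [pow_zero, mul_one, P.map_zero, one_mul, pow_one] at h
  rw [h]
  congr 1
  simp

theorem φ_mem_center_iff {m : M} : P.φ m ∈ Subgroup.center T ↔ D.op m = 0 := by
  rw [Subgroup.mem_center_iff]
  constructor
  · intro h
    have h1 := h P.σ
    rw [P.conj] at h1
    simpa using P.inj (mul_right_cancel h1)
  · intro h t
    obtain ⟨n, k, rfl⟩ := P.exists_eq t
    have hk : ((1 + D.op) ^ k) m = m := by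
      rw [Module.End.pow_apply]
      exact Function.iterate_fixed (by simp [h]) k
    rw [mul_assoc, P.gen_pow_mul, hk, ← mul_assoc, P.commute, mul_assoc]

theorem pow_prime_eq [Fact p.Prime] (m : M) (a : ℕ) :
    ∃ n ∈ LinearMap.range (D.op ^ (p - 1)), (P.φ m * P.σ ^ a) ^ p = P.φ (n + a • D.z) := by
  refine ⟨_, geom_sum_one_add_pow_mem D.op a m, ?_⟩
  rw [P.mul_pow_eq, mul_comm a p, pow_mul, P.pow_eq, P.map_add, P.map_nsmul]

/-- `D` does not describe an elementary abelian group. -/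
def _root_.TGroups.CyclicDatum.IsRegular (D : CyclicDatum p M) : Prop := D.op ≠ 0 ∨ D.z ≠ 0

/-- If `φ m * σ ^ k` is central with `k` prime to `p`, then `(1 + x) ^ k = 1 = (1 + x) ^ p` forces
`x = 0`; its `p`-th power is then `k • z`, so order dividing `p` forces `z = 0`. This is the
elementary abelian case that regularity excludes. -/
theorem centerTorsion_eq [Fact p.Prime] (hD : D.IsRegular) :
    centerTorsion p T = P.image (LinearMap.ker D.op) := by
  have hp := (Fact.out : p.Prime)
  ext t
  constructor
  · rintro ⟨hc, ht⟩
    obtain ⟨m, k, rfl⟩ := P.exists_eq t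
    by_cases hk : p ∣ k
    · obtain ⟨d, rfl⟩ := hk
      rw [pow_mul, P.pow_eq, ← P.map_nsmul, ← P.map_add] at hc ⊢
      exact P.φ_mem_image.mpr (P.φ_mem_center_iff.mp hc)
    · exfalso
      have h1 : (1 + D.op) ^ k = 1 := by
        ext n
        have h2 := P.commutator_eq n m 0 k
        rw [pow_zero, mul_one, commutatorElement_eq_one_iff_mul_comm.mpr
          (Subgroup.mem_center_iff.mp hc (P.φ n)), ← P.map_zero] at h2
        have h3 := P.inj h2
        rw [pow_zero, Module.End.one_apply, sub_self, zero_sub, eq_comm, neg_eq_zero,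
          sub_eq_zero] at h3
        exact h3
      have h2 : (1 + D.op) ^ p = 1 := by rw [one_add_pow_prime, D.op_pow, add_zero]
      have hop : D.op = 0 := by
        have := pow_gcd_eq_one.mpr ⟨h1, h2⟩
        rw [Nat.Coprime.gcd_eq_one ((hp.coprime_iff_not_dvd.mpr hk).symm), pow_one] at this
        simpa using this
      rcases hD with h | h
      · exact h hop
      · obtain ⟨n, ⟨y, rfl⟩, hn⟩ := P.pow_prime_eq m k
        rw [hop, zero_pow (by have := hp.two_le; omega), LinearMap.zero_apply, zero_add] at hn
        change (P.φ m * P.σ ^ k) ^ p = 1 at ht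
        rw [ht, ← P.map_zero] at hn
        have hz := P.inj hn
        rw [← Nat.cast_smul_eq_nsmul (ZMod p), eq_comm, smul_eq_zero] at hz
        rcases hz with hz | hz
        · exact hk ((ZMod.natCast_eq_zero_iff k p).mp hz)
        · exact h hz
  · rintro ⟨m, hm, rfl⟩
    refine ⟨P.φ_mem_center_iff.mpr hm, ?_⟩
    rw [← P.map_nsmul, ← Nat.cast_smul_eq_nsmul (ZMod p), CharP.cast_eq_zero, zero_smul,
      P.map_zero]

section CentralSeries

variable [IsTopologicalGroup T] [T2Space T] [CompactSpace M] [T2Space M]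

/-- Each commutator with `T` gains one factor `x`, and commutators with `σ` already give all of the
range of the next power. Ranges of powers of `x` are compact, so taking closures adds nothing. -/
theorem centralSeries_eq (k : ℕ) :
    centralSeries T (k + 2) = P.image (LinearMap.range (D.op ^ (k + 1))) := by
  have hclosed : ∀ k, IsClosed (P.image (LinearMap.range (D.op ^ k)) : Set T) := fun k =>
    P.isClosed_image (isClosed_range_pow D.op_cont k)
  induction k with
  | zero =>
    change (⁅(⊤ : Subgroup T), (⊤ : Subgroup T)⁆).topologicalClosure = _
    apply le_antisymm
    · refine Subgroup.topologicalClosure_minimal _ (Subgroup.commutator_le.mpr ?_) (hclosed _)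
      intro g _ h _
      obtain ⟨m, a, rfl⟩ := P.exists_eq g
      obtain ⟨n, b, rfl⟩ := P.exists_eq h
      rw [P.commutator_eq, P.φ_mem_image]
      exact sub_mem (one_add_pow_sub_mem _ _ ⟨n, rfl⟩) (one_add_pow_sub_mem _ _ ⟨m, rfl⟩)
    · rintro _ ⟨_, ⟨m, rfl⟩, rfl⟩
      refine Subgroup.le_topologicalClosure _ ?_
      have := P.commutator_gen (-m)
      rw [_root_.map_neg, neg_neg] at this
      rw [zero_add, pow_one, ← this]
      exact Subgroup.commutator_mem_commutator trivial trivial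
  | succ k ih =>
    change (⁅centralSeries T (k + 2), (⊤ : Subgroup T)⁆).topologicalClosure = _
    rw [ih]
    apply le_antisymm
    · refine Subgroup.topologicalClosure_minimal _ (Subgroup.commutator_le.mpr ?_) (hclosed _)
      rintro _ ⟨m, hm, rfl⟩ h _
      obtain ⟨n, b, rfl⟩ := P.exists_eq h
      have := P.commutator_eq m n 0 b
      rw [pow_zero, mul_one, pow_zero, Module.End.one_apply, sub_self, zero_sub] at this
      rw [this, P.φ_mem_image]
      exact Submodule.neg_mem _ (one_add_pow_sub_mem _ _ hm)
    · rintro _ ⟨_, ⟨m, rfl⟩, rfl⟩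
      refine Subgroup.le_topologicalClosure _ ?_
      have := P.commutator_gen ((D.op ^ (k + 1)) (-m))
      rw [_root_.map_neg, _root_.map_neg, neg_neg, ← Module.End.mul_apply, ← pow_succ'] at this
      rw [← this]
      exact Subgroup.commutator_mem_commutator
        (P.φ_mem_image.mpr ⟨-m, _root_.map_neg _ m⟩) trivial

theorem center_inf_centralSeries (k : ℕ) :
    Subgroup.center T ⊓ centralSeries T (k + 2) =
      P.image (LinearMap.ker D.op ⊓ LinearMap.range (D.op ^ (k + 1))) := by
  rw [P.centralSeries_eq]
  ext t
  constructor
  · rintro ⟨hc, m, hm, rfl⟩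
    exact ⟨m, ⟨P.φ_mem_center_iff.mp hc, hm⟩, rfl⟩
  · rintro ⟨m, ⟨hc, hm⟩, rfl⟩
    exact ⟨P.φ_mem_center_iff.mpr hc, m, hm, rfl⟩

/-- Every `p`-th power is a multiple of `z` up to the range of `x ^ (p - 1)`, and `hk` puts that
range inside the range of `x ^ (k + 1)`. -/
theorem powerSubgroup_le_iff [Fact p.Prime] (P : Presentation D T) {k : ℕ} (hk : k + 2 ≤ p) :
    powerSubgroup p T ≤ centralSeries T (k + 2) ↔ D.z ∈ LinearMap.range (D.op ^ (k + 1)) := by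
  rw [P.centralSeries_eq]
  constructor
  · intro h
    rw [← P.φ_mem_image, ← P.pow_eq]
    exact h (Subgroup.le_topologicalClosure _ (Subgroup.subset_closure ⟨P.σ, rfl⟩))
  · intro h
    refine Subgroup.topologicalClosure_minimal _ ((Subgroup.closure_le _).mpr ?_)
      (P.isClosed_image (isClosed_range_pow D.op_cont _))
    rintro _ ⟨t, rfl⟩
    obtain ⟨m, a, rfl⟩ := P.exists_eq t
    obtain ⟨n, hn, h1⟩ := P.pow_prime_eq m a
    refine ⟨n + a • D.z, add_mem (range_pow_antitone _ (by omega) hn)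
      (Submodule.smul_of_tower_mem _ a h), h1.symm⟩

end CentralSeries

/-- The quotient is `S` modulo `S'`, which `π` identifies with `𝔽_p ^ I`. By compactness `S` maps
onto it by a topological quotient map, so continuity of `π` descends. -/
theorem dimH1_eq [Fact p.Prime] [T2Space T] [CompactSpace M] {A K : Subgroup T}
    {S S' : Submodule (ZMod p) M} (hS : IsClosed (S : Set M)) (hA : A = P.image S)
    (hK : Subgroup.center T ⊓ K = P.image S') {I : Type v} (π : S →ₗ[ZMod p] I → ZMod p)
    (hπ : Continuous π) (hsurj : Function.Surjective π) (hker : ∀ s, π s = 0 ↔ s.1 ∈ S') :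
    dimH1 p T A K = Cardinal.mk I := by
  subst hA
  have : CompactSpace S := isCompact_iff_compactSpace.mp hS.isCompact
  let φ' : S → P.image S := fun s => ⟨P.φ s, P.φ_mem_image.mpr s.2⟩
  have hφ'c : Continuous φ' := (P.cont.comp continuous_subtype_val).subtype_mk _
  have hφ's : Function.Surjective φ' := by
    rintro ⟨_, m, hm, rfl⟩
    exact ⟨⟨m, hm⟩, rfl⟩
  let q : S → P.image S ⧸ (Subgroup.center T ⊓ K).subgroupOf (P.image S) := fun s => φ' s
  have hq : Topology.IsQuotientMap q :=
    (QuotientGroup.isQuotientMap_mk _).comp (hφ'c.isClosedMap.isQuotientMap hφ'c hφ's)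
  have hqadd : ∀ s s', q (s + s') = q s * q s' := by
    intro s s'
    have : φ' (s + s') = φ' s * φ' s' := Subtype.ext (P.map_add _ _)
    exact congrArg (QuotientGroup.mk' _) this
  have hqπ : ∀ s s', q s = q s' ↔ π s = π s' := by
    intro s s'
    rw [QuotientGroup.eq, Subgroup.mem_subgroupOf, hK, eq_comm, ← sub_eq_zero, ← map_sub, hker,
      ← P.φ_mem_image]
    have : (((φ' s)⁻¹ * φ' s' : P.image S) : T) = P.φ (s' - s : S) := by
      change (P.φ s)⁻¹ * P.φ s' = P.φ (s' - s)
      rw [← P.map_neg, ← P.map_add, neg_add_eq_sub]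
    rw [this]
  have : CompactSpace (P.image S ⧸ (Subgroup.center T ⊓ K).subgroupOf (P.image S)) :=
    hq.surjective.compactSpace hq.continuous
  let g := fun x => π (Function.surjInv hq.surjective x)
  have hg : ∀ s, g (q s) = π s := fun s => (hqπ _ _).mp (Function.surjInv_eq hq.surjective (q s))
  refine rank_H1_eq g ?_ ⟨?_, ?_⟩ ?_
  · rw [hq.continuous_iff]
    exact hπ.congr fun s => (hg s).symm
  · intro x y hxy
    obtain ⟨s, rfl⟩ := hq.surjective x
    obtain ⟨s', rfl⟩ := hq.surjective y
    rw [hg, hg] at hxy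
    exact (hqπ _ _).mpr hxy
  · intro a
    obtain ⟨s, rfl⟩ := hsurj a
    exact ⟨q s, hg s⟩
  · intro x y
    obtain ⟨s, rfl⟩ := hq.surjective x
    obtain ⟨s', rfl⟩ := hq.surjective y
    rw [← hqadd, hg, hg, hg, _root_.map_add]

section Invariants

variable [Fact p.Prime] {β : Type v} {len : β → ℕ} {hlen : ∀ b, len b ≤ p} {z : Coord p len}
  {hz : shift p len z = 0} [T2Space T]

/-- In the kernel of the shift only zeroth coordinates survive, and in the range of its `k`-th power
only those of blocks longer than `k`. Passing from `k` to `k + 1` loses exactly the blocks of length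
`k + 1`. -/
theorem dimH1_coord (P : Presentation (coordDatum hlen z hz) T) (k : ℕ) {A K : Subgroup T}
    (hA : A = P.image (LinearMap.ker (shift p len) ⊓ LinearMap.range (shift p len ^ k)))
    (hK : Subgroup.center T ⊓ K =
      P.image (LinearMap.ker (shift p len) ⊓ LinearMap.range (shift p len ^ (k + 1)))) :
    dimH1 p T A K = Cardinal.mk {b // len b = k + 1} := by
  classical
  let π : ↥(LinearMap.ker (shift p len) ⊓ LinearMap.range (shift p len ^ k)) →ₗ[ZMod p]
      {b // len b = k + 1} → ZMod p :=
    { toFun := fun s b => s.1.1 b 0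
      map_add' := fun _ _ => rfl
      map_smul' := fun _ _ => rfl }
  refine P.dimH1_eq ?_ hA hK π ?_ ?_ ?_
  · exact (isClosed_eq continuous_shift continuous_const).inter
      (isClosed_range_pow continuous_shift k)
  · exact continuous_pi fun b => (continuous_apply_apply b.1 0).comp
      (continuous_subtype_val.comp continuous_subtype_val)
  · intro a
    have hmem : (fun b j => if h : len b = k + 1 ∧ j = 0 then a ⟨b, h.1⟩ else 0) ∈ Coord p len :=
      fun b j hj => dif_neg (by omega)
    refine ⟨⟨⟨_, hmem⟩, shift_eq_zero_iff.mpr fun b j => dif_neg (by omega),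
      mem_range_shift_pow.mpr fun b j hj => dif_neg (by omega)⟩, ?_⟩
    funext b
    exact dif_pos ⟨b.2, rfl⟩
  · rintro ⟨n, hn1, hn2⟩
    have h1 := shift_eq_zero_iff.mp hn1
    have h2 := mem_range_shift_pow.mp hn2
    constructor
    · intro h
      refine ⟨hn1, mem_range_shift_pow.mpr fun b j hj => ?_⟩
      cases j with
      | zero =>
        by_cases hb : len b = k + 1
        · exact congrFun h ⟨b, hb⟩
        · exact h2 b 0 (by omega)
      | succ j => exact h1 b j
    · rintro ⟨-, h⟩
      funext b
      exact mem_range_shift_pow.mp h b 0 (by rw [b.2]; omega)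

variable [IsTopologicalGroup T]

/-- The invariants `t_i` of a product of Jordan blocks count the blocks of size `i`. -/
theorem tInv_eq (P : Presentation (coordDatum hlen z hz) T)
    (hD : (coordDatum hlen z hz).IsRegular) {i : ℕ} (hi : 1 ≤ i) :
    tInv p T i = Cardinal.mk {b // len b = i} := by
  obtain ⟨k, rfl⟩ := Nat.exists_eq_add_of_le' hi
  unfold tInv
  cases k with
  | zero =>
    rw [if_pos rfl]
    refine P.dimH1_coord 0 ?_ (P.center_inf_centralSeries 0)
    rw [P.centerTorsion_eq hD, pow_zero, show LinearMap.range (1 : Module.End (ZMod p) _) = ⊤ from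
      LinearMap.range_id, inf_top_eq]
    rfl
  | succ k =>
    rw [if_neg (by omega)]
    exact P.dimH1_coord (k + 1) (P.center_inf_centralSeries k) (P.center_inf_centralSeries (k + 1))

theorem uInv_eq_of_zero (P : Presentation (coordDatum hlen z hz) T) (h0 : z = 0) :
    uInv p T = p := by
  have hp := (Fact.out : p.Prime).two_le
  refine uInv_eq_of_isGreatest ⟨⟨by omega, le_rfl, ?_⟩, fun i hi => hi.2.1⟩
  obtain ⟨k, hk⟩ := Nat.exists_eq_add_of_le' hp
  subst h0
  have := (P.powerSubgroup_le_iff (k := k) (by omega)).mpr (Submodule.zero_mem _)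
  rwa [← hk] at this

theorem uInv_eq_of_unitVec {b₀ : β} {hpos : 1 ≤ len b₀}
    (P : Presentation (coordDatum hlen _ (shift_unitVec hpos)) T) : uInv p T = len b₀ := by
  -- The unit vector is the end of a chain of `len b₀` vectors, so it is hit by exactly `len b₀ - 1`
  -- shifts at most.
  have key : ∀ k, unitVec p len b₀ hpos ∈ LinearMap.range (shift p len ^ k) ↔ k < len b₀ := by
    intro k
    rw [mem_range_shift_pow]
    constructor
    · intro h
      by_contra hk
      have := h b₀ 0 (by omega)
      rw [unitVec_apply_self] at this
      exact one_ne_zero this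
    · intro hk b j hj
      by_cases hb : b = b₀
      · subst hb
        obtain ⟨j, rfl⟩ := Nat.exists_eq_add_of_le' (show 1 ≤ j by omega)
        exact shift_eq_zero_iff.mp (shift_unitVec hpos) b j
      · exact unitVec_apply_of_ne hpos hb j
  refine uInv_eq_of_isGreatest ⟨⟨hpos, hlen b₀, ?_⟩, ?_⟩
  · obtain ⟨k, hk⟩ := Nat.exists_eq_add_of_le' hpos
    cases k with
    | zero =>
      rw [hk]
      exact le_top
    | succ k =>
      rw [hk]
      exact (P.powerSubgroup_le_iff (by have := hlen b₀; omega)).mpr ((key _).mpr (by omega))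
  · rintro i ⟨hi1, hip, hi⟩
    obtain ⟨k, rfl⟩ := Nat.exists_eq_add_of_le' hi1
    cases k with
    | zero => exact hpos
    | succ k => exact (key _).mp ((P.powerSubgroup_le_iff hip).mp hi)

end Invariants

end Presentation

/-! ### Normal forms: uniqueness and construction of the extension. -/

theorem div_add_mod_add_div {p : ℕ} (hp : 0 < p) (x y : ℕ) :
    x / p + (x % p + y) / p = (x + y) / p := by
  conv_rhs => rw [← Nat.div_add_mod x p, add_assoc, Nat.mul_add_div hp]

/-- If `σ ^ p` and some power of `σ` with exponent prime to `p` lie in `K`, so does `σ`. -/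
theorem mem_of_zpow_mem {p : ℕ} [hp : Fact p.Prime] {G : Type*} [Group G] {K : Subgroup G} {σ : G}
    (h1 : σ ^ p ∈ K) {i : ℤ} (h2 : σ ^ i ∈ K) (hi : ¬ (p : ℤ) ∣ i) : σ ∈ K := by
  obtain ⟨a, b, hab⟩ :=
    (Nat.prime_iff_prime_int.mp hp.out).irreducible.coprime_iff_not_dvd.mpr hi
  have : σ = (σ ^ p) ^ a * (σ ^ i) ^ b := by
    rw [← zpow_natCast, ← zpow_mul, ← zpow_mul, ← zpow_add, mul_comm (p : ℤ), mul_comm i, hab,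
      zpow_one]
  rw [this]
  exact K.mul_mem (K.zpow_mem h1 _) (K.zpow_mem h2 _)

namespace CyclicDatum

variable {p : ℕ} {M : Type v} [AddCommGroup M] [Module (ZMod p) M] [TopologicalSpace M]
  (D : CyclicDatum p M)

/-- The multiplication of the extension described by `D`, in terms of normal forms. -/
def mul (x y : M × ZMod p) : M × ZMod p :=
  (x.1 + ((1 + D.op) ^ x.2.val) y.1 + ((x.2.val + y.2.val) / p) • D.z, x.2 + y.2)

theorem op_pow_z (k : ℕ) : ((1 + D.op) ^ k) D.z = D.z := by
  rw [Module.End.pow_apply]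
  exact Function.iterate_fixed (by simp [D.op_z]) k

variable [Fact p.Prime]

theorem one_add_op_pow : (1 + D.op) ^ p = 1 := by rw [one_add_pow_prime, D.op_pow, add_zero]

theorem pow_val_add (a b : ZMod p) :
    (1 + D.op) ^ (a + b).val = (1 + D.op) ^ a.val * (1 + D.op) ^ b.val := by
  rw [ZMod.val_add, ← pow_eq_pow_mod _ D.one_add_op_pow, pow_add]

/-- The multiples of `z` are the carries in addition modulo `p`; under either bracketing the total
carry is the sum of the three representatives divided by `p`. -/
theorem mul_assoc (x y w : M × ZMod p) : D.mul (D.mul x y) w = D.mul x (D.mul y w) := by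
  have hp : 0 < p := (Fact.out : p.Prime).pos
  refine Prod.ext ?_ (add_assoc _ _ _)
  simp only [mul, map_add, map_nsmul, op_pow_z, ZMod.val_add]
  have h1 := div_add_mod_add_div hp (x.2.val + y.2.val) w.2.val
  have h2 := div_add_mod_add_div hp (y.2.val + w.2.val) x.2.val
  have h3 : ((x.2.val + y.2.val) / p) • D.z + (((x.2.val + y.2.val) % p + w.2.val) / p) • D.z =
      ((y.2.val + w.2.val) / p) • D.z + ((x.2.val + (y.2.val + w.2.val) % p) / p) • D.z := by
    rw [← add_smul, ← add_smul, h1, add_comm x.2.val ((y.2.val + w.2.val) % p), h2]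
    congr 2
    omega
  have h4 : ((1 + D.op) ^ ((x.2.val + y.2.val) % p)) w.1 =
      ((1 + D.op) ^ x.2.val) (((1 + D.op) ^ y.2.val) w.1) := by
    rw [← ZMod.val_add, pow_val_add, Module.End.mul_apply]
  rw [h4, add_right_comm _ (_ • D.z), add_assoc, h3]
  abel

end CyclicDatum

namespace Presentation

variable {p : ℕ} {M : Type v} [AddCommGroup M] [Module (ZMod p) M]
  [TopologicalSpace M] {D : CyclicDatum p M} {T : Type v} [Group T] [TopologicalSpace T]
  (P : Presentation D T)

theorem gen_pow_mem : P.σ ^ p ∈ P.image ⊤ := ⟨D.z, trivial, P.pow_eq.symm⟩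

theorem gen_notMem : P.σ ∉ P.image ⊤ := by
  rintro ⟨m, -, h⟩
  exact P.ne_gen m h

/-- The parametrization of `T` by normal forms. -/
def param (x : M × ZMod p) : T := P.φ x.1 * P.σ ^ x.2.val

theorem param_continuous [IsTopologicalGroup T] : Continuous P.param :=
  (P.cont.comp continuous_fst).mul
    ((continuous_of_discreteTopology (f := fun a : ZMod p => P.σ ^ a.val)).comp continuous_snd)

variable [Fact p.Prime]

theorem param_mul (x y : M × ZMod p) : P.param x * P.param y = P.param (D.mul x y) := by
  unfold param CyclicDatum.mul
  rw [P.mul_mul_mul, P.map_add _ (_ • _), P.map_nsmul, ← P.pow_eq, ← pow_mul, _root_.mul_assoc,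
    ← pow_add, ZMod.val_add, Nat.div_add_mod]

/-- Two normal forms of one element put `σ ^ (a - b)` in the kernel `φ(M)`; if `p` did not divide `a
- b`, then `σ` itself would lie there. -/
theorem param_bijective : Function.Bijective P.param := by
  have hp := (Fact.out : p.Prime)
  constructor
  · rintro ⟨m, a⟩ ⟨n, b⟩ h
    change P.φ m * P.σ ^ a.val = P.φ n * P.σ ^ b.val at h
    have hmem : P.σ ^ ((a.val : ℤ) - b.val) ∈ P.image ⊤ := by
      refine ⟨-m + n, trivial, ?_⟩
      rw [P.map_add, P.map_neg, zpow_sub, zpow_natCast, zpow_natCast, eq_mul_inv_iff_mul_eq,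
        _root_.mul_assoc, ← h, inv_mul_cancel_left]
    have hdvd : (p : ℤ) ∣ (a.val : ℤ) - b.val := by
      by_contra hd
      exact P.gen_notMem (mem_of_zpow_mem P.gen_pow_mem hmem hd)
    have hab : a = b := by
      rw [← ZMod.intCast_zmod_eq_zero_iff_dvd] at hdvd
      simpa [sub_eq_zero] using hdvd
    subst hab
    rw [P.inj (mul_right_cancel h)]
  · intro t
    obtain ⟨m, k, rfl⟩ := P.exists_eq t
    refine ⟨(m + (k / p) • D.z, (k : ZMod p)), ?_⟩
    change P.φ _ * P.σ ^ (k : ZMod p).val = _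
    rw [P.map_add, P.map_nsmul, ← P.pow_eq, ← pow_mul, _root_.mul_assoc, ← pow_add,
      ZMod.val_natCast, Nat.div_add_mod]

/-- A group is determined by a datum presenting it. -/
theorem nonempty_equiv [CompactSpace M] [IsTopologicalGroup T] [T2Space T] {T' : Type v} [Group T']
    [TopologicalSpace T'] [IsTopologicalGroup T'] [T2Space T'] (P : Presentation D T)
    (P' : Presentation D T') : Nonempty (T ≃ₜ* T') := by
  let e : M × ZMod p ≃ₜ T := Continuous.homeoOfEquivCompactToT2
    (f := Equiv.ofBijective P.param P.param_bijective) P.param_continuous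
  let e' : M × ZMod p ≃ₜ T' := Continuous.homeoOfEquivCompactToT2
    (f := Equiv.ofBijective P'.param P'.param_bijective) P'.param_continuous
  have he : ∀ x y, e x * e y = e (D.mul x y) := P.param_mul
  have he' : ∀ x y, e' x * e' y = e' (D.mul x y) := P'.param_mul
  refine ⟨{ (e.symm.trans e') with
    map_mul' := fun s t => ?_
    continuous_toFun := (e.symm.trans e').continuous
    continuous_invFun := (e.symm.trans e').symm.continuous }⟩
  obtain ⟨x, rfl⟩ := e.surjective s
  obtain ⟨y, rfl⟩ := e.surjective t
  change e' (e.symm (e x * e y)) = e' (e.symm (e x)) * e' (e.symm (e y))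
  rw [he, e.symm_apply_apply, e.symm_apply_apply, e.symm_apply_apply, he']

/-- Every group presented by a datum is a `T`-group. -/
theorem isTGroup [CompactSpace M] {T : ProfiniteGrp.{v}} (P : Presentation D T) :
    IsTGroup p T where
  nontrivial := ⟨⟨1, P.σ, P.map_zero ▸ P.ne_gen 0⟩⟩
  proP U := by
    -- A `p`-th power lies in the kernel, which has exponent dividing `p`; thus `p ^ 2` kills
    -- everything.
    refine IsPGroup.to_quotient (fun t => ⟨2, ?_⟩) _
    obtain ⟨m, a, rfl⟩ := P.exists_eq t
    obtain ⟨n, -, hn⟩ := P.pow_prime_eq m a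
    rw [pow_two, pow_mul, hn, ← P.map_nsmul, ← Nat.cast_smul_eq_nsmul (ZMod p),
      CharP.cast_eq_zero, zero_smul, P.map_zero]
  exists_maximal := by
    refine ⟨P.image ⊤, ⟨⟨P.isClosed_image isClosed_univ, ?_⟩, ?_⟩, ?_, ?_⟩
    · intro h
      exact P.gen_notMem (h ▸ Subgroup.mem_top _)
    · rintro H ⟨-, hH⟩ hle t ht
      obtain ⟨m, k, rfl⟩ := P.exists_eq t
      have hφ : ∀ m, P.φ m ∈ P.image ⊤ := fun m => P.φ_mem_image.mpr trivial
      by_contra hnot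
      have hk : P.σ ^ (k : ℤ) ∈ H := by
        rw [zpow_natCast]
        exact (Subgroup.mul_mem_cancel_left _ (hle (hφ m))).mp ht
      have hσ : P.σ ∈ H := by
        refine mem_of_zpow_mem (hle P.gen_pow_mem) hk fun hd => hnot ?_
        obtain ⟨d, rfl⟩ := Int.natCast_dvd_natCast.mp hd
        rw [pow_mul]
        exact Subgroup.mul_mem _ (hφ m) (Subgroup.pow_mem _ P.gen_pow_mem d)
      refine hH (H.eq_top_iff'.mpr fun s => ?_)
      obtain ⟨n, l, rfl⟩ := P.exists_eq s
      exact H.mul_mem (hle (hφ n)) (H.pow_mem hσ l)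
    · rintro _ ⟨m, -, rfl⟩ _ ⟨n, -, rfl⟩
      exact P.commute m n
    · rintro _ ⟨m, -, rfl⟩
      rw [← P.map_nsmul, ← Nat.cast_smul_eq_nsmul (ZMod p), CharP.cast_eq_zero, zero_smul,
        P.map_zero]

end Presentation

/-- The extension of `ℤ/p` described by `D`. -/
def CyclicDatum.Extension {p : ℕ} {M : Type v} [AddCommGroup M] [Module (ZMod p) M]
    [TopologicalSpace M] (_ : CyclicDatum p M) : Type v := M × ZMod p

namespace CyclicDatum.Extension

variable {p : ℕ} {M : Type v} [AddCommGroup M] [Module (ZMod p) M]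
  [TopologicalSpace M] {D : CyclicDatum p M}

theorem continuous_pow_val [IsTopologicalAddGroup M] :
    Continuous fun y : ZMod p × M => ((1 + D.op) ^ y.1.val) y.2 := by
  rw [continuous_prod_of_discrete_left]
  intro a
  change Continuous fun m => ((1 + D.op) ^ a.val) m
  rw [Module.End.coe_pow]
  exact (continuous_id.add D.op_cont).iterate _

instance : TopologicalSpace D.Extension := inferInstanceAs (TopologicalSpace (M × ZMod p))

variable [Fact p.Prime]

instance : Group D.Extension :=
  letI : Mul D.Extension := ⟨D.mul⟩
  letI : One D.Extension := ⟨((0, 0) : M × ZMod p)⟩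
  -- The first component is the solution of the left inverse equation, including the carry term.
  letI : Inv D.Extension := ⟨fun x => ((-(((1 + D.op) ^ (-x.2).val) x.1 +
    (((-x.2).val + x.2.val) / p) • D.z), -x.2) : M × ZMod p)⟩
  Group.ofLeftAxioms D.mul_assoc
    (fun x => by
      change D.mul (0, 0) x = x
      refine Prod.ext ?_ (zero_add _)
      simp [CyclicDatum.mul, Nat.div_eq_of_lt (ZMod.val_lt x.2)])
    (fun x => by
      change D.mul (-(((1 + D.op) ^ (-x.2).val) x.1 +
        (((-x.2).val + x.2.val) / p) • D.z), -x.2) x = (0, 0)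
      refine Prod.ext ?_ (neg_add_cancel _)
      simp only [CyclicDatum.mul]
      abel)

theorem mul_def (x y : D.Extension) : x * y = D.mul x y := rfl

/-- The element of the extension with the given normal form. -/
def mk (D : CyclicDatum p M) (m : M) (a : ZMod p) : D.Extension := ((m, a) : M × ZMod p)

variable (D) in
theorem gen_pow (k : ℕ) :
    mk D 0 1 ^ k = mk D ((k / p) • D.z) k := by
  have hp := (Fact.out : p.Prime)
  have : Fact (1 < p) := ⟨hp.one_lt⟩
  induction k with
  | zero =>
    rw [pow_zero, Nat.zero_div, zero_smul, Nat.cast_zero]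
    rfl
  | succ k ih =>
    rw [pow_succ, ih, mul_def]
    refine Prod.ext ?_ (Nat.cast_succ k).symm
    simp only [CyclicDatum.mul, mk, map_zero, add_zero, ZMod.val_one, ZMod.val_natCast]
    rw [← add_smul, div_add_mod_add_div hp.pos]

variable (D) in
theorem mk_mul_mk (m n : M) (a : ZMod p) : mk D m 0 * mk D n a = mk D (m + n) a := by
  rw [mul_def]
  refine Prod.ext ?_ (zero_add _)
  simp [CyclicDatum.mul, mk, Nat.div_eq_of_lt (ZMod.val_lt a)]

/-- The tautological presentation of the extension. -/
def presentation (D : CyclicDatum p M) : Presentation D D.Extension where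
  φ m := mk D m 0
  σ := mk D 0 1
  map_add m n := (mk_mul_mk D m n 0).symm
  cont := Continuous.prodMk_left (0 : ZMod p)
  inj := Prod.mk_left_injective (0 : ZMod p)
  conj m := by
    have hp := (Fact.out : p.Prime)
    have : Fact (1 < p) := ⟨hp.one_lt⟩
    rw [mk_mul_mk, mul_def]
    refine Prod.ext ?_ (add_zero _)
    simp [CyclicDatum.mul, mk, ZMod.val_one, Nat.div_eq_of_lt hp.one_lt]
  pow_eq := by
    rw [gen_pow, Nat.div_self (Fact.out : p.Prime).pos, one_smul, CharP.cast_eq_zero]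
  ne_gen m h := zero_ne_one (congrArg Prod.snd h)
  exists_eq t := by
    refine ⟨t.1, t.2.val, ?_⟩
    rw [gen_pow, mk_mul_mk, Nat.div_eq_of_lt (ZMod.val_lt t.2), zero_smul, add_zero,
      ZMod.natCast_zmod_val]
    rfl

variable [IsTopologicalAddGroup M]

instance : IsTopologicalGroup D.Extension where
  continuous_mul := by
    have h1 : Continuous fun y : (M × ZMod p) × (M × ZMod p) =>
        ((1 + D.op) ^ y.1.2.val) y.2.1 :=
      continuous_pow_val.comp (f := fun y : (M × ZMod p) × (M × ZMod p) => (y.1.2, y.2.1))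
        (by fun_prop)
    have h2 : Continuous fun y : (M × ZMod p) × (M × ZMod p) =>
        ((y.1.2.val + y.2.2.val) / p) • D.z :=
      (continuous_of_discreteTopology (f := fun y : ZMod p × ZMod p =>
        ((y.1.val + y.2.val) / p) • D.z)).comp
        (f := fun y : (M × ZMod p) × (M × ZMod p) => (y.1.2, y.2.2)) (by fun_prop)
    have h3 : Continuous fun y : (M × ZMod p) × (M × ZMod p) => D.mul y.1 y.2 :=
      (((continuous_fst.comp continuous_fst).add h1).add h2).prodMk (by fun_prop)
    exact h3
  continuous_inv := by
    have h1 : Continuous fun y : M × ZMod p => ((1 + D.op) ^ (-y.2).val) y.1 :=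
      continuous_pow_val.comp (f := fun y : M × ZMod p => (-y.2, y.1)) (by fun_prop)
    have h2 : Continuous fun y : M × ZMod p => (((-y.2).val + y.2.val) / p) • D.z :=
      (continuous_of_discreteTopology (f := fun a : ZMod p =>
        (((-a).val + a.val) / p) • D.z)).comp continuous_snd
    exact (h1.add h2).neg.prodMk continuous_snd.neg

instance [CompactSpace M] : CompactSpace D.Extension :=
  inferInstanceAs (CompactSpace (M × ZMod p))

instance [TotallyDisconnectedSpace M] : TotallyDisconnectedSpace D.Extension :=
  inferInstanceAs (TotallyDisconnectedSpace (M × ZMod p))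

end CyclicDatum.Extension

/-! ### Elementary abelian `T`-groups. -/

section Elementary

variable {p : ℕ}

/-- `g` is an isomorphism of `T` with the elementary abelian group `𝔽_p ^ I`. -/
structure IsElementaryChart {T : Type v} [Group T] [TopologicalSpace T] {I : Type v}
    (g : T → I → ZMod p) : Prop where
  cont : Continuous g
  bij : Function.Bijective g
  map_mul : ∀ a b, g (a * b) = g a + g b

namespace IsElementaryChart

variable {T : Type v} [Group T] [TopologicalSpace T] {I : Type v} {g : T → I → ZMod p}

theorem map_one (hg : IsElementaryChart g) : g 1 = 0 := by
  have := hg.map_mul 1 1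
  rwa [one_mul, left_eq_add] at this

theorem map_pow (hg : IsElementaryChart g) (t : T) (k : ℕ) : g (t ^ k) = k • g t := by
  induction k with
  | zero => rw [pow_zero, hg.map_one, zero_smul]
  | succ k ih => rw [pow_succ, hg.map_mul, ih, succ_nsmul]

theorem mul_comm (hg : IsElementaryChart g) (a b : T) : a * b = b * a :=
  hg.bij.1 (by rw [hg.map_mul, hg.map_mul, add_comm])

theorem pow_eq_one (hg : IsElementaryChart g) (a : T) : a ^ p = 1 :=
  hg.bij.1 (by
    rw [hg.map_pow, hg.map_one]
    ext i
    simp)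

theorem center_eq_top (hg : IsElementaryChart g) : Subgroup.center T = ⊤ :=
  (Subgroup.eq_top_iff' _).mpr fun a => Subgroup.mem_center_iff.mpr fun b => hg.mul_comm b a

variable [IsTopologicalGroup T] [T2Space T]

theorem centralSeries_eq_bot (hg : IsElementaryChart g) (k : ℕ) : centralSeries T (k + 2) = ⊥ := by
  have h : ⁅centralSeries T (k + 1), (⊤ : Subgroup T)⁆ = ⊥ := by
    rw [eq_bot_iff, Subgroup.commutator_le]
    intro a _ b _
    exact commutatorElement_eq_one_iff_mul_comm.mpr (hg.mul_comm a b)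
  change (⁅centralSeries T (k + 1), (⊤ : Subgroup T)⁆).topologicalClosure = ⊥
  rw [h, eq_bot_iff]
  exact Subgroup.topologicalClosure_minimal _ le_rfl isClosed_singleton

theorem uInv_eq (hg : IsElementaryChart g) (hp : 1 ≤ p) : uInv p T = p := by
  refine uInv_eq_of_isGreatest ⟨⟨hp, le_rfl, ?_⟩, fun i hi => hi.2.1⟩
  have h : powerSubgroup p T ≤ ⊥ := by
    refine Subgroup.topologicalClosure_minimal _ ((Subgroup.closure_le _).mpr ?_)
      isClosed_singleton
    rintro _ ⟨a, rfl⟩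
    exact hg.pow_eq_one a
  exact h.trans bot_le

theorem dimH1_centralSeries (hg : IsElementaryChart g) [Fact p.Prime] (k l : ℕ) :
    dimH1 p T (Subgroup.center T ⊓ centralSeries T (k + 2)) (centralSeries T l) = 0 := by
  rw [hg.centralSeries_eq_bot, inf_bot_eq]
  have hsub : Subsingleton ((⊥ : Subgroup T) ⧸
      (Subgroup.center T ⊓ centralSeries T l).subgroupOf ⊥) :=
    (QuotientGroup.mk_surjective).subsingleton
  exact (rank_H1_eq (I := PEmpty.{v + 1}) (fun _ i => i.elim) continuous_const
    ⟨fun _ _ _ => Subsingleton.elim _ _, fun _ => ⟨1, Subsingleton.elim _ _⟩⟩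
    fun _ _ => Subsingleton.elim _ _).trans Cardinal.mk_pempty

theorem dimH1_centerTorsion (hg : IsElementaryChart g) [Fact p.Prime] [CompactSpace T] :
    dimH1 p T (centerTorsion p T) (centralSeries T 2) = Cardinal.mk I := by
  have htop : centerTorsion p T = ⊤ :=
    (Subgroup.eq_top_iff' _).mpr fun a => ⟨by rw [hg.center_eq_top]; trivial, hg.pow_eq_one a⟩
  rw [htop]
  have hL : (Subgroup.center T ⊓ centralSeries T 2).subgroupOf ⊤ = ⊥ := by
    rw [hg.centralSeries_eq_bot, inf_bot_eq, Subgroup.bot_subgroupOf]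
  have : CompactSpace (⊤ : Subgroup T) := isCompact_iff_compactSpace.mp isCompact_univ
  let q : (⊤ : Subgroup T) → (⊤ : Subgroup T) ⧸
    (Subgroup.center T ⊓ centralSeries T 2).subgroupOf ⊤ := QuotientGroup.mk
  have hqi : Function.Injective q := by
    intro a b h
    have h1 := QuotientGroup.eq.mp h
    rw [hL, Subgroup.mem_bot, inv_mul_eq_one] at h1
    exact h1
  have hqs : Function.Surjective q := QuotientGroup.mk_surjective
  let g' : (⊤ : Subgroup T) ⧸ (Subgroup.center T ⊓ centralSeries T 2).subgroupOf ⊤ → I → ZMod p :=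
    fun x => g (Function.surjInv hqs x : (⊤ : Subgroup T))
  have hg' : ∀ a, g' (q a) = g a := fun a =>
    congrArg (fun t : (⊤ : Subgroup T) => g t) (hqi (Function.surjInv_eq hqs (q a)))
  refine rank_H1_eq g' ?_ ⟨?_, ?_⟩ ?_
  · rw [(QuotientGroup.isQuotientMap_mk _).continuous_iff]
    exact (hg.cont.comp continuous_subtype_val).congr fun a => (hg' a).symm
  · intro x y hxy
    obtain ⟨a, rfl⟩ := hqs x
    obtain ⟨b, rfl⟩ := hqs y
    rw [hg', hg'] at hxy
    rw [Subtype.ext (hg.bij.1 hxy)]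
  · intro c
    obtain ⟨a, rfl⟩ := hg.bij.2 c
    exact ⟨q ⟨a, trivial⟩, hg' _⟩
  · intro x y
    obtain ⟨a, rfl⟩ := hqs x
    obtain ⟨b, rfl⟩ := hqs y
    rw [hg', hg']
    exact (hg' (a * b)).trans (hg.map_mul a b)

theorem tInv_one (hg : IsElementaryChart g) [Fact p.Prime] [CompactSpace T] :
    tInv p T 1 = Cardinal.mk I := by
  rw [tInv, if_pos rfl, hg.dimH1_centerTorsion]

theorem tInv_of_two_le (hg : IsElementaryChart g) [Fact p.Prime] {i : ℕ} (hi : 2 ≤ i) :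
    tInv p T i = 0 := by
  obtain ⟨k, rfl⟩ := Nat.exists_eq_add_of_le' hi
  rw [tInv, if_neg (by omega), hg.dimH1_centralSeries]

end IsElementaryChart

theorem IsElementaryChart.isTGroup [Fact p.Prime] {T : ProfiniteGrp.{v}} {I : Type v} [Nonempty I]
    {g : T → I → ZMod p} (hg : IsElementaryChart g) : IsTGroup p T := by
  obtain ⟨i₀⟩ := ‹Nonempty I›
  classical
  obtain ⟨s, hs⟩ := hg.bij.2 (Pi.single i₀ 1)
  have hs1 : g s i₀ = 1 := by rw [hs, Pi.single_eq_same]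
  have hinv : ∀ a, g a⁻¹ = -g a := fun a => by
    rw [eq_neg_iff_add_eq_zero, ← hg.map_mul, inv_mul_cancel, hg.map_one]
  refine ⟨⟨⟨1, s, fun h => ?_⟩⟩, fun U => ?_, ?_⟩
  · rw [← h, hg.map_one] at hs1
    exact zero_ne_one hs1
  · exact IsPGroup.to_quotient (fun t => ⟨1, by rw [pow_one]; exact hg.pow_eq_one t⟩) _
  · let N : Subgroup T :=
      { carrier := {t | g t i₀ = 0}
        one_mem' := by
          change g 1 i₀ = 0
          rw [hg.map_one]
          rfl
        mul_mem' := fun {a b} ha hb => by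
          change g a i₀ = 0 at ha
          change g b i₀ = 0 at hb
          change g (a * b) i₀ = 0
          rw [hg.map_mul, Pi.add_apply, ha, hb, add_zero]
        inv_mem' := fun {a} ha => by
          change g a i₀ = 0 at ha
          change g a⁻¹ i₀ = 0
          rw [hinv, Pi.neg_apply, ha, neg_zero] }
    have hmem : ∀ t, t ∈ N ↔ g t i₀ = 0 := fun _ => Iff.rfl
    refine ⟨N, ⟨⟨?_, fun h => ?_⟩, ?_⟩, fun a _ b _ => hg.mul_comm a b, fun a _ => hg.pow_eq_one a⟩
    · exact isClosed_eq ((continuous_apply i₀).comp hg.cont) continuous_const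
    · have : s ∈ N := h ▸ Subgroup.mem_top s
      rw [hmem, hs1] at this
      exact one_ne_zero this
    · rintro H ⟨-, hH⟩ hle t ht
      by_contra hnot
      rw [hmem] at hnot
      refine hH (H.eq_top_iff'.mpr fun r => ?_)
      -- The exponent is chosen to cancel the coordinate `i₀` of `r`.
      have hr : r * (t ^ (g r i₀ / g t i₀).val)⁻¹ ∈ N := by
        rw [hmem, hg.map_mul, hinv, hg.map_pow, Pi.add_apply, Pi.neg_apply, Pi.smul_apply,
          ← Nat.cast_smul_eq_nsmul (ZMod p), ZMod.natCast_zmod_val, smul_eq_mul,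
          div_mul_cancel₀ _ hnot, add_neg_cancel]
      exact (Subgroup.mul_mem_cancel_right _ (H.inv_mem (H.pow_mem ht _))).mp (hle hr)

/-- A basis of the continuous dual serves as a coordinate system. -/
theorem exists_bijective_characters (p : ℕ) [Fact p.Prime] (M : Type v) [AddCommGroup M]
    [Module (ZMod p) M] [TopologicalSpace M] [IsTopologicalAddGroup M] [CompactSpace M]
    [TotallyDisconnectedSpace M] :
    ∃ (I : Type v) (g : M → I → ZMod p), Continuous g ∧ Function.Bijective g ∧
      ∀ a b, g (a + b) = g a + g b := by
  let b := Module.Basis.ofVectorSpace (ZMod p) (M →L[ZMod p] ZMod p)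
  refine ⟨_, fun t i => b i t, continuous_pi fun i => (b i).continuous, ⟨?_, ?_⟩, ?_⟩
  · exact fun s t h => eq_of_forall_character_eq b.span_eq.ge fun i => congrFun h i
  · intro a
    obtain ⟨m, hm⟩ := exists_forall_character_eq b.linearIndependent a
    exact ⟨m, funext hm⟩
  · exact fun s t => funext fun i => map_add (b i) s t

open scoped IsMulCommutative in
theorem exists_isElementaryChart [Fact p.Prime] {T : Type v} [Group T] [TopologicalSpace T]
    [IsTopologicalGroup T] [CompactSpace T] [TotallyDisconnectedSpace T]
    (hcomm : ∀ a b : T, a * b = b * a) (hexp : ∀ a : T, a ^ p = 1) :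
    ∃ (I : Type v) (g : T → I → ZMod p), IsElementaryChart g := by
  have : IsMulCommutative T := ⟨⟨hcomm⟩⟩
  let _ : Module (ZMod p) (Additive T) := AddCommGroup.zmodModule fun m : Additive T =>
    congrArg Additive.ofMul (hexp m.toMul)
  have : CompactSpace (Additive T) := ‹CompactSpace T›
  have : TotallyDisconnectedSpace (Additive T) := ‹TotallyDisconnectedSpace T›
  obtain ⟨I, g, hc, hb, hadd⟩ := exists_bijective_characters p (Additive T)
  exact ⟨I, fun t => g (Additive.ofMul t), hc.comp continuous_ofMul,
    hb.comp Additive.ofMul.bijective, fun s t => hadd (Additive.ofMul s) (Additive.ofMul t)⟩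

theorem IsElementaryChart.nonempty_equiv {T T' : Type v} [Group T] [TopologicalSpace T]
    [CompactSpace T] [Group T'] [TopologicalSpace T'] [CompactSpace T'] {I I' : Type v}
    {g : T → I → ZMod p} {g' : T' → I' → ZMod p} (hg : IsElementaryChart g)
    (hg' : IsElementaryChart g') (ε : I ≃ I') : Nonempty (T ≃ₜ* T') := by
  let e : T ≃ₜ (I → ZMod p) :=
    Continuous.homeoOfEquivCompactToT2 (f := Equiv.ofBijective g hg.bij) hg.cont
  let e' : T' ≃ₜ (I' → ZMod p) :=
    Continuous.homeoOfEquivCompactToT2 (f := Equiv.ofBijective g' hg'.bij) hg'.cont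
  have he : ∀ a b, e (a * b) = e a + e b := hg.map_mul
  have he' : ∀ a b, e' (a * b) = e' a + e' b := hg'.map_mul
  let E : T ≃ₜ T' := (e.trans (Homeomorph.piCongrLeft (Y := fun _ => ZMod p) ε)).trans e'.symm
  refine ⟨{ E with
    map_mul' := fun s t => ?_
    continuous_toFun := E.continuous
    continuous_invFun := E.symm.continuous }⟩
  apply e'.injective
  change e' (E (s * t)) = e' (E s * E t)
  rw [he']
  simp only [E, Homeomorph.trans_apply, Homeomorph.apply_symm_apply, he]
  funext i
  obtain ⟨j, rfl⟩ := ε.surjective i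
  simp

end Elementary

/-! ### Classification by invariants and realization. -/

section Classification

variable {p : ℕ}

theorem Presentation.exists_isElementaryChart [Fact p.Prime] {M : Type v} [AddCommGroup M]
    [Module (ZMod p) M] [TopologicalSpace M] {D : CyclicDatum p M} {T : Type v} [Group T]
    [TopologicalSpace T] [IsTopologicalGroup T] [CompactSpace T] [TotallyDisconnectedSpace T] (P : Presentation D T)
    (hD : ¬ D.IsRegular) : ∃ (I : Type v) (g : T → I → ZMod p), IsElementaryChart g := by
  obtain ⟨hop, hz⟩ : D.op = 0 ∧ D.z = 0 := by
    unfold CyclicDatum.IsRegular at hD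
    push Not at hD
    exact hD
  have hp := (Fact.out : p.Prime).two_le
  refine TGroups.exists_isElementaryChart (fun a b => ?_) fun a => ?_
  · obtain ⟨m, k, rfl⟩ := P.exists_eq a
    obtain ⟨n, l, rfl⟩ := P.exists_eq b
    rw [P.mul_mul_mul, P.mul_mul_mul, hop, add_zero, one_pow, one_pow, Module.End.one_apply,
      Module.End.one_apply, add_comm m, add_comm k]
  · obtain ⟨m, k, rfl⟩ := P.exists_eq a
    obtain ⟨_, ⟨y, rfl⟩, h⟩ := P.pow_prime_eq m k
    rw [h, hop, hz, smul_zero, add_zero, zero_pow (by omega), LinearMap.zero_apply, P.map_zero]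

theorem shift_ne_zero [Fact p.Prime] {β : Type v} {len : β → ℕ} {b : β} (hb : 2 ≤ len b) :
    shift p len ≠ 0 := by
  classical
  intro h
  have hmem : (fun b' j => if b' = b ∧ j = 1 then (1 : ZMod p) else 0) ∈ Coord p len :=
    fun b' j hj => if_neg (by
      rintro ⟨rfl, rfl⟩
      omega)
  have := shift_apply (⟨_, hmem⟩ : Coord p len) b 0
  rw [h] at this
  simp at this

theorem shift_eq_zero_of_le {β : Type v} {len : β → ℕ} (h : ∀ b, len b ≤ 1) :
    shift p len = 0 := by
  simpa using shift_pow_eq_zero (p := p) h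

theorem unitVec_ne_zero [Fact p.Prime] {β : Type v} {len : β → ℕ} {b₀ : β} (h : 1 ≤ len b₀) :
    unitVec p len b₀ h ≠ 0 := by
  intro h0
  have := unitVec_apply_self (p := p) h
  rw [h0] at this
  exact zero_ne_one this

/-- `T` is an extension with the given Jordan blocks that splits and is not abelian. -/
def IsSplitType (p : ℕ) {β : Type v} (len : β → ℕ) (T : Type v) [Group T] [TopologicalSpace T] :
    Prop :=
  (∃ b, 2 ≤ len b) ∧ ∃ hlen : ∀ b, len b ≤ p,
    Nonempty (Presentation (coordDatum (len := len) hlen 0 (map_zero _)) T)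

/-- `T` is an extension with the given Jordan blocks whose power element is the first basis vector
of the block `b₀`, which has size less than `p`. -/
def IsNonsplitType (p : ℕ) {β : Type v} (len : β → ℕ) (b₀ : β) (T : Type v) [Group T]
    [TopologicalSpace T] : Prop :=
  len b₀ < p ∧ ∃ (hlen : ∀ b, len b ≤ p) (hpos : 1 ≤ len b₀),
    Nonempty (Presentation (coordDatum hlen _ (shift_unitVec hpos)) T)

/-- Every `T`-group is elementary abelian, or a split nonabelian extension, or a nonsplit
extension. -/
theorem IsTGroup.classification [Fact p.Prime] {T : ProfiniteGrp.{v}} (hT : IsTGroup p T) :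
    (∃ (I : Type v) (g : T → I → ZMod p), IsElementaryChart g) ∨
    ∃ (β : Type v) (len : β → ℕ), (∀ b, 1 ≤ len b ∧ len b ≤ p) ∧
      (IsSplitType p len T ∨ ∃ b₀, IsNonsplitType p len b₀ T) := by
  obtain ⟨β, len, hpos, hlen, ⟨⟨P⟩⟩ | ⟨b₀, hb₀, hP⟩⟩ := hT.exists_presentation
  · by_cases h : ∃ b, 2 ≤ len b
    · exact Or.inr ⟨β, len, fun b => ⟨hpos b, hlen b⟩, Or.inl ⟨h, hlen, ⟨P⟩⟩⟩
    · push Not at h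
      refine Or.inl (P.exists_isElementaryChart ?_)
      rintro (h1 | h1)
      · exact h1 (shift_eq_zero_of_le fun b => Nat.lt_succ_iff.mp (h b))
      · exact h1 rfl
  · exact Or.inr ⟨β, len, fun b => ⟨hpos b, hlen b⟩, Or.inr ⟨b₀, hb₀, hlen, hpos b₀, hP⟩⟩

section Types

variable [Fact p.Prime] {β : Type v} {len : β → ℕ} {T : Type v} [Group T] [TopologicalSpace T]
  [IsTopologicalGroup T] [T2Space T]

theorem IsSplitType.tInv_eq (h : IsSplitType p len T) {i : ℕ} (hi : 1 ≤ i) :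
    tInv p T i = Cardinal.mk {b // len b = i} := by
  obtain ⟨⟨b, hb⟩, hlen, ⟨P⟩⟩ := h
  exact P.tInv_eq (Or.inl (shift_ne_zero hb)) hi

theorem IsSplitType.uInv_eq (h : IsSplitType p len T) : uInv p T = p := by
  obtain ⟨-, hlen, ⟨P⟩⟩ := h
  exact P.uInv_eq_of_zero rfl

theorem IsSplitType.exists_tInv_ne_zero (h : IsSplitType p len T) :
    ∃ i, 2 ≤ i ∧ i ≤ p ∧ tInv p T i ≠ 0 := by
  obtain ⟨b, hb⟩ := h.1
  refine ⟨len b, hb, h.2.1 b, ?_⟩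
  rw [h.tInv_eq (by omega), Cardinal.mk_ne_zero_iff]
  exact ⟨⟨b, rfl⟩⟩

theorem IsNonsplitType.tInv_eq {b₀ : β} (h : IsNonsplitType p len b₀ T) {i : ℕ} (hi : 1 ≤ i) :
    tInv p T i = Cardinal.mk {b // len b = i} := by
  obtain ⟨-, hlen, hpos, ⟨P⟩⟩ := h
  exact P.tInv_eq (Or.inr (unitVec_ne_zero hpos)) hi

theorem IsNonsplitType.uInv_eq {b₀ : β} (h : IsNonsplitType p len b₀ T) :
    uInv p T = len b₀ := by
  obtain ⟨-, hlen, hpos, ⟨P⟩⟩ := h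
  exact P.uInv_eq_of_unitVec

end Types

section Reindex

variable {β β' : Type v} {len : β → ℕ} {len' : β' → ℕ}

/-- The index set is the disjoint union of the fibres of `len`, and fibres outside `1, ..., p` are
empty. -/
theorem exists_equiv_of_fibers (h : ∀ b, 1 ≤ len b ∧ len b ≤ p)
    (h' : ∀ b, 1 ≤ len' b ∧ len' b ≤ p)
    (hc : ∀ i, 1 ≤ i → i ≤ p → Cardinal.mk {b // len b = i} = Cardinal.mk {b // len' b = i}) :
    ∃ ε : β ≃ β', ∀ b, len' (ε b) = len b := by
  have hf : ∀ i, Nonempty ({b // len b = i} ≃ {b // len' b = i}) := by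
    intro i
    by_cases hi : 1 ≤ i ∧ i ≤ p
    · exact Cardinal.eq.mp (hc i hi.1 hi.2)
    · have : IsEmpty {b // len b = i} := ⟨fun b => hi (b.2 ▸ h b.1)⟩
      have : IsEmpty {b // len' b = i} := ⟨fun b => hi (b.2 ▸ h' b.1)⟩
      exact ⟨Equiv.equivOfIsEmpty _ _⟩
  let e := fun i => (hf i).some
  exact ⟨((Equiv.sigmaFiberEquiv len).symm.trans (Equiv.sigmaCongrRight e)).trans
    (Equiv.sigmaFiberEquiv len'), fun b => (e (len b) ⟨b, rfl⟩).2⟩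

/-- Relabelling of the Jordan blocks. -/
def coordReindex (p : ℕ) (ε : β ≃ β') (hε : ∀ b, len' (ε b) = len b) :
    Coord p len ≃ₗ[ZMod p] Coord p len' where
  toFun n := ⟨fun b' j => n.1 (ε.symm b') j, fun b' j hj => n.2 _ _ (by
    rwa [← hε, ε.apply_symm_apply])⟩
  invFun n := ⟨fun b j => n.1 (ε b) j, fun b j hj => n.2 _ _ (by rwa [hε])⟩
  map_add' _ _ := rfl
  map_smul' _ _ := rfl
  left_inv n := by
    ext b j
    exact congrArg (fun b => n.1 b j) (ε.symm_apply_apply b)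
  right_inv n := by
    ext b j
    exact congrArg (fun b => n.1 b j) (ε.apply_symm_apply b)

theorem coordReindex_apply (ε : β ≃ β') (hε : ∀ b, len' (ε b) = len b) (n : Coord p len) (b' : β')
    (j : ℕ) : (coordReindex p ε hε n).1 b' j = n.1 (ε.symm b') j := rfl

theorem continuous_coordReindex (ε : β ≃ β') (hε : ∀ b, len' (ε b) = len b) :
    Continuous (coordReindex p ε hε) := by
  refine Continuous.subtype_mk (continuous_pi fun b => continuous_pi fun j => ?_) _
  exact (continuous_apply_apply (ε.symm b) j).comp continuous_subtype_val

theorem IsSplitType.reindex {T : Type v} [Group T] [TopologicalSpace T]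
    (h : IsSplitType p len' T) (ε : β ≃ β') (hε : ∀ b, len' (ε b) = len b) :
    IsSplitType p len T := by
  obtain ⟨⟨b, hb⟩, hlen, ⟨P⟩⟩ := h
  refine ⟨⟨ε.symm b, by rwa [← hε, ε.apply_symm_apply]⟩, fun b => hε b ▸ hlen _, ⟨?_⟩⟩
  exact P.comp (coordReindex p ε hε) (continuous_coordReindex ε hε) (fun _ => rfl)
    (coordReindex p ε hε).map_zero

theorem IsNonsplitType.reindex {T : Type v} [Group T] [TopologicalSpace T] {b₀ : β'}
    (h : IsNonsplitType p len' b₀ T) (ε : β ≃ β') (hε : ∀ b, len' (ε b) = len b) :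
    IsNonsplitType p len (ε.symm b₀) T := by
  obtain ⟨hb, hlen, hpos, ⟨P⟩⟩ := h
  have hb₀ : len (ε.symm b₀) = len' b₀ := by rw [← hε, ε.apply_symm_apply]
  have hpos' : 1 ≤ len (ε.symm b₀) := hb₀ ▸ hpos
  refine ⟨hb₀ ▸ hb, fun b => hε b ▸ hlen _, hpos', ⟨?_⟩⟩
  refine P.comp (coordReindex p ε hε) (continuous_coordReindex ε hε) (fun _ => rfl) ?_
  refine eq_unitVec hpos ?_ (fun b hb => ?_) fun b j => ?_
  · rw [coordReindex_apply]
    exact unitVec_apply_self hpos'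
  · rw [coordReindex_apply]
    exact unitVec_apply_of_ne hpos' (fun h => hb (ε.symm.injective h)) 0
  · rw [coordReindex_apply]
    exact shift_eq_zero_iff.mp (shift_unitVec hpos') _ j

variable [Fact p.Prime] {T T' : Type v} [Group T] [TopologicalSpace T] [IsTopologicalGroup T]
  [T2Space T] [Group T'] [TopologicalSpace T'] [IsTopologicalGroup T'] [T2Space T']

theorem IsSplitType.nonempty_equiv (h : IsSplitType p len T) (h' : IsSplitType p len' T')
    (hlen : ∀ b, 1 ≤ len b ∧ len b ≤ p) (hlen' : ∀ b, 1 ≤ len' b ∧ len' b ≤ p)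
    (ht : ∀ i, 1 ≤ i → i ≤ p → tInv p T i = tInv p T' i) : Nonempty (T ≃ₜ* T') := by
  obtain ⟨ε, hε⟩ := exists_equiv_of_fibers hlen hlen' fun i hi hip => by
    rw [← h.tInv_eq hi, ← h'.tInv_eq hi, ht i hi hip]
  obtain ⟨-, _, ⟨P⟩⟩ := h
  obtain ⟨-, _, ⟨P'⟩⟩ := h'.reindex ε hε
  exact P.nonempty_equiv P'

theorem IsNonsplitType.nonempty_equiv {b₀ : β} {b₀' : β'} (h : IsNonsplitType p len b₀ T)
    (h' : IsNonsplitType p len' b₀' T') (hlen : ∀ b, 1 ≤ len b ∧ len b ≤ p)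
    (hlen' : ∀ b, 1 ≤ len' b ∧ len' b ≤ p)
    (ht : ∀ i, 1 ≤ i → i ≤ p → tInv p T i = tInv p T' i) (hu : uInv p T = uInv p T') :
    Nonempty (T ≃ₜ* T') := by
  classical
  obtain ⟨ε₀, hε₀⟩ := exists_equiv_of_fibers hlen hlen' fun i hi hip => by
    rw [← h.tInv_eq hi, ← h'.tInv_eq hi, ht i hi hip]
  rw [h.uInv_eq, h'.uInv_eq] at hu
  -- The marked blocks both have length `u`, so a transposition makes the relabelling match them
  -- without changing lengths.
  obtain ⟨ε, hε, hb⟩ : ∃ ε : β ≃ β', (∀ b, len' (ε b) = len b) ∧ ε.symm b₀' = b₀ := by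
    refine ⟨ε₀.trans (Equiv.swap (ε₀ b₀) b₀'), fun b => ?_, ?_⟩
    · rw [← hε₀ b, Equiv.trans_apply, Equiv.swap_apply_def]
      split_ifs with h1 h2
      · rw [h1, hε₀, hu]
      · rw [h2, hε₀, hu]
      · rfl
    · simp
  have h'' := h'.reindex ε hε
  rw [hb] at h''
  obtain ⟨-, _, _, ⟨P⟩⟩ := h
  obtain ⟨-, _, _, ⟨P'⟩⟩ := h''
  exact P.nonempty_equiv P'

end Reindex

/-- The Jordan blocks with prescribed multiplicities `t i`, `1 ≤ i ≤ p`. -/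
def BlockIndex (p : ℕ) (t : ℕ → Cardinal.{v}) : Type v := Σ i : Fin p, (t (i + 1)).out

/-- The size of a block. -/
def BlockIndex.len {t : ℕ → Cardinal.{v}} (b : BlockIndex p t) : ℕ := (b.1 : ℕ) + 1

theorem BlockIndex.mk_fiber (t : ℕ → Cardinal.{v}) {i : ℕ} (hi : 1 ≤ i) (hip : i ≤ p) :
    Cardinal.mk {b : BlockIndex p t // b.len = i} = t i := by
  obtain ⟨k, rfl⟩ := Nat.exists_eq_add_of_le' hi
  have e : {b : BlockIndex p t // b.len = k + 1} ≃ (t (k + 1)).out :=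
    (Equiv.subtypeEquivRight fun b : BlockIndex p t =>
      show b.len = k + 1 ↔ b.1 = ⟨k, hip⟩ by
        rw [Fin.ext_iff]
        exact Nat.succ_inj).trans
      (Equiv.sigmaSubtype (β := fun i : Fin p => (t (i + 1)).out) ⟨k, hip⟩)
  rw [Cardinal.mk_congr e, Cardinal.mk_out]

theorem BlockIndex.exists_len_eq {t : ℕ → Cardinal.{v}} {i : ℕ} (hi : 1 ≤ i) (hip : i ≤ p)
    (h : t i ≠ 0) : ∃ b : BlockIndex p t, b.len = i := by
  rw [← BlockIndex.mk_fiber t hi hip, Cardinal.mk_ne_zero_iff] at h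
  obtain ⟨b⟩ := h
  exact ⟨b.1, b.2⟩

variable [Fact p.Prime]

/-- `T`-groups with the same invariants are isomorphic. -/
theorem IsTGroup.nonempty_equiv {T T' : ProfiniteGrp.{v}} (hT : IsTGroup p T)
    (hT' : IsTGroup p T') (ht : ∀ i, 1 ≤ i → i ≤ p → tInv p T i = tInv p T' i)
    (hu : uInv p T = uInv p T') : Nonempty (T ≃ₜ* T') := by
  have hp := (Fact.out : p.Prime).one_le
  -- The invariants separate the three types: `u < p` exactly in the nonsplit case, and for `u = p`
  -- some `t_i` with `i ≥ 2` is nonzero exactly in the split nonabelian case.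
  rcases hT.classification with ⟨I, g, hg⟩ | ⟨β, len, hlen, h | ⟨b₀, h⟩⟩ <;>
    rcases hT'.classification with ⟨I', g', hg'⟩ | ⟨β', len', hlen', h' | ⟨b₀', h'⟩⟩
  · have h1 := ht 1 le_rfl hp
    rw [hg.tInv_one, hg'.tInv_one] at h1
    obtain ⟨ε⟩ := Cardinal.eq.mp h1
    exact hg.nonempty_equiv hg' ε
  · obtain ⟨i, hi, hip, h0⟩ := h'.exists_tInv_ne_zero
    exact absurd ((ht i (by omega) hip).symm.trans (hg.tInv_of_two_le hi)) h0
  · rw [hg.uInv_eq hp, h'.uInv_eq] at hu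
    exact absurd hu h'.1.ne'
  · obtain ⟨i, hi, hip, h0⟩ := h.exists_tInv_ne_zero
    exact absurd ((ht i (by omega) hip).trans (hg'.tInv_of_two_le hi)) h0
  · exact h.nonempty_equiv h' hlen hlen' ht
  · rw [h.uInv_eq, h'.uInv_eq] at hu
    exact absurd hu h'.1.ne'
  · rw [hg'.uInv_eq hp, h.uInv_eq] at hu
    exact absurd hu h.1.ne
  · rw [h.uInv_eq, h'.uInv_eq] at hu
    exact absurd hu h.1.ne
  · exact h.nonempty_equiv h' hlen hlen' ht hu

theorem IsTGroup.invariants_spec {T : ProfiniteGrp.{v}} (hT : IsTGroup p T) :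
    (uInv p T < p → 1 ≤ tInv p T (uInv p T)) ∧
      (uInv p T = p → (∀ i, 2 ≤ i → i ≤ p → tInv p T i = 0) → 1 ≤ tInv p T 1) := by
  have hp := (Fact.out : p.Prime).one_le
  rcases hT.classification with ⟨I, g, hg⟩ | ⟨β, len, hlen, h | ⟨b₀, h⟩⟩
  · refine ⟨fun h => absurd (hg.uInv_eq hp) h.ne, fun _ _ => ?_⟩
    rw [hg.tInv_one, Cardinal.one_le_iff_ne_zero, Cardinal.mk_ne_zero_iff]
    by_contra hI
    rw [not_nonempty_iff] at hI
    obtain ⟨s, t, hst⟩ := hT.nontrivial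
    exact hst (hg.bij.1 (Subsingleton.elim _ _))
  · refine ⟨fun h' => absurd h.uInv_eq h'.ne, fun _ h0 => ?_⟩
    obtain ⟨i, hi, hip, hne⟩ := h.exists_tInv_ne_zero
    exact absurd (h0 i hi hip) hne
  · refine ⟨fun _ => ?_, fun h' => absurd (h.uInv_eq.symm.trans h') h.1.ne⟩
    rw [h.uInv_eq, h.tInv_eq (hlen b₀).1, Cardinal.one_le_iff_ne_zero, Cardinal.mk_ne_zero_iff]
    exact ⟨⟨b₀, rfl⟩⟩

/-- Every admissible family of cardinals is the family of invariants of a `T`-group. -/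
theorem exists_isTGroup (t : ℕ → Cardinal.{v}) {u : ℕ} (hu : 1 ≤ u) (hup : u ≤ p)
    (h1 : u < p → 1 ≤ t u) (h2 : u = p → (∀ i, 2 ≤ i → i ≤ p → t i = 0) → 1 ≤ t 1) :
    ∃ T : ProfiniteGrp.{v}, IsTGroup p T ∧ (∀ i, 1 ≤ i → i ≤ p → tInv p T i = t i) ∧
      uInv p T = u := by
  have hp := (Fact.out : p.Prime).one_le
  have hlen : ∀ b : BlockIndex p t, b.len ≤ p := fun b => b.1.2
  have htd : TotallyDisconnectedSpace (Coord p (BlockIndex.len (p := p) (t := t))) :=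
    inferInstance
  rcases hup.lt_or_eq with hlt | rfl
  · obtain ⟨b₀, hb₀⟩ := BlockIndex.exists_len_eq hu hup (Cardinal.one_le_iff_ne_zero.mp (h1 hlt))
    let D := coordDatum hlen _ (shift_unitVec (show 1 ≤ b₀.len from hb₀ ▸ hu))
    let T := ProfiniteGrp.of D.Extension
    have hT : IsNonsplitType p BlockIndex.len b₀ T :=
      ⟨hb₀ ▸ hlt, hlen, hb₀ ▸ hu, ⟨CyclicDatum.Extension.presentation D⟩⟩
    refine ⟨T, ?_, fun i hi hip => ?_, ?_⟩
    · exact Presentation.isTGroup (T := T) (CyclicDatum.Extension.presentation D)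
    · rw [hT.tInv_eq hi, BlockIndex.mk_fiber t hi hip]
    · rw [hT.uInv_eq, hb₀]
  · by_cases h0 : ∀ i, 2 ≤ i → i ≤ u → t i = 0
    -- With no block longer than `1` and nothing marked, the block construction would give an
    -- elementary abelian group with `t_1` too large by the contribution of `σ`; the power `𝔽_p ^ (t
    -- 1)` is used instead, and `t 1 ≠ 0` makes it nontrivial.
    · have hne : Nonempty (t 1).out := by
        rw [← Cardinal.mk_ne_zero_iff, Cardinal.mk_out]
        exact Cardinal.one_le_iff_ne_zero.mp (h2 rfl h0)
      let T := ProfiniteGrp.of (Multiplicative ((t 1).out → ZMod u))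
      have hT : IsElementaryChart (T := T) (fun x => Multiplicative.toAdd x) :=
        ⟨continuous_toAdd, Multiplicative.toAdd.bijective, fun _ _ => rfl⟩
      refine ⟨T, hT.isTGroup, fun i hi hip => ?_, hT.uInv_eq hp⟩
      rcases hi.lt_or_eq with hi2 | rfl
      · rw [hT.tInv_of_two_le hi2, h0 i hi2 hip]
      · rw [hT.tInv_one, Cardinal.mk_out]
    · push Not at h0
      obtain ⟨i, hi, hiu, hne⟩ := h0
      obtain ⟨b, hb⟩ := BlockIndex.exists_len_eq (by omega) hiu hne
      let D := coordDatum (len := BlockIndex.len (p := u) (t := t)) hlen 0 (map_zero _)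
      let T := ProfiniteGrp.of D.Extension
      have hT : IsSplitType u (BlockIndex.len (p := u) (t := t)) T :=
        ⟨⟨b, hb ▸ hi⟩, hlen, ⟨CyclicDatum.Extension.presentation D⟩⟩
      refine ⟨T, ?_, fun i hi hip => ?_, hT.uInv_eq⟩
      · exact Presentation.isTGroup (T := T) (CyclicDatum.Extension.presentation D)
      · rw [hT.tInv_eq hi, BlockIndex.mk_fiber t hi hip]

end Classification

end TGroups

theorem mainTheorem4 (p : ℕ) [Fact p.Prime] :
    (∀ (t : ℕ → Cardinal.{v}) (u : ℕ), 1 ≤ u → u ≤ p →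
      ((∃ T : ProfiniteGrp.{v}, TGroups.IsTGroup p T ∧
          (∀ i, 1 ≤ i → i ≤ p → TGroups.tInv p T i = t i) ∧ TGroups.uInv p T = u) ↔
        ((u < p → 1 ≤ t u) ∧
          (u = p → (∀ i, 2 ≤ i → i ≤ p → t i = 0) → 1 ≤ t 1)))) ∧
    (∀ T T' : ProfiniteGrp.{v}, TGroups.IsTGroup p T → TGroups.IsTGroup p T' →
      (∀ i, 1 ≤ i → i ≤ p → TGroups.tInv p T i = TGroups.tInv p T' i) →
      TGroups.uInv p T = TGroups.uInv p T' → Nonempty (T ≃ₜ* T')) := by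
  refine ⟨fun t u hu hup => ⟨?_, fun h => TGroups.exists_isTGroup t hu hup h.1 h.2⟩,
    fun T T' hT hT' ht hu => hT.nonempty_equiv hT' ht hu⟩
  rintro ⟨T, hT, ht, rfl⟩
  have hp := (Fact.out : p.Prime).one_le
  obtain ⟨h1, h2⟩ := hT.invariants_spec
  rw [ht _ hu hup, ht 1 le_rfl hp] at *
  exact ⟨h1, fun h h0 => h2 h fun i hi hip => (ht i (by omega) hip).trans (h0 i hi hip)⟩
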